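/- **Model.** Let $K_1,K_2\in\mathbb N$, $K=K_1+K_2$, $C,\kappa>0$, $d_0\ge 0$ and $d_1\in\mathbb R$ be fixed, let $f:\mathbb R\to[0,1]$ be an increasing, twice differentiable link function, and let $a_n>0$ with $a_n\to0$. For $t\in\mathbb Z$ and $x\in\mathbb R$ put $F(t\mid x)=1$ if $t\le -1$, $F(t\mid x)=f(d_t+x)$ if $t\in\{0,1\}$, $F(t\mid x)=0$ if $t\ge 2$, and $p(t\mid x)=F(t\mid x)-F(t+1\mid x)$. For each $n$ let $\mathbf B^*=\mathbf B^*_n\in\mathbb R^{n\times K_1}$ and $\mathbf A^*=\mathbf A_n^*\in\mathbb R^{n\times K_2}$ have rows $\beta_i^*$ and $\alpha_i^*$, and put $l^*_{ij}=-\|\beta_i^*-\beta_j^*\|^2$, $\mathbf S^*=\mathbf A^*(\mathbf A^*)^\top=(s^*_{ij})$, $\mathbf M^*=\mathbf L^*+\mathbf S^*$. One observes a symmetric random matrix $\mathbf Y=(y_{ij})$ with entries in $\{-1,0,1\}$ such that the $y_{ij}$, $i\le j$, are independent and $\Pr(y_{ij}\ge t)=F(t\mid m^*_{ij})$ for all $t$.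 **Estimator.** $(\widehat{\mathbf B},\widehat{\mathbf A})\in\mathbb R^{n\times K_1}\times\mathbb R^{n\times K_2}$ is a minimizer of $-\sum_{i,j=1}^n\log p(y_{ij}\mid m_{ij})$, with $m_{ij}=-\|\beta_i-\beta_j\|^2+\alpha_i^\top\alpha_j$, over all $(\mathbf B,\mathbf A)$ with $\|\mathbf B\|_{2\to\infty}\le C$, $\|\mathbf A\|_{2\to\infty}\le C$, $\mathbf 1_n^\top\mathbf B=0$, $\mathbf 1_n^\top\mathbf A=0$, $\mathbf B^\top\mathbf A=0$ and $\|\mathbf A\|_F\le\kappa\sqrt{a_n}\,\|\mathbf B\|_F$, where $\|\cdot\|_{2\to\infty}$ is the largest Euclidean norm of a row. Put $\widehat{\mathbf S}=\widehat{\mathbf A}\widehat{\mathbf A}^\top=(\widehat s_{ij})$. **Constants.** For $\alpha=5C^2+d_0$ let $$G=\max_{t\in\{-1,0,1\}}\sup_{|x|\le\alpha}\frac{|p'(t\mid x)|}{p(t\mid x)},\qquad H=\min_{t\in\{-1,0,1\}}\inf_{|x|\le\alpha}\Big\{\frac{p'(t\mid x)^2}{p(t\mid x)^2}-\frac{p''(t\mid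 x)}{p(t\mid x)}\Big\},$$ where the derivatives are taken in $x$, let $r_n=4.02\sqrt{2(K+2)/n}\;G/H$ and $s_{\min}=\min_{s^*_{ij}\ne0}|s^*_{ij}|$. **Assumptions.** * (A1) $\|\mathbf B^*\|_{2\to\infty}\le C$ and $\|\mathbf A^*\|_{2\to\infty}\le C$ for all $n$; $p(t\mid x)>0$ for $t\in\{-1,0,1\}$, $|x|\le\alpha$; $G<\infty$; $H>0$. * (A2) $\mathbf 1_n^\top\mathbf B^*=0$, $\mathbf 1_n^\top\mathbf A^*=0$ and $(\mathbf B^*)^\top\mathbf A^*=0$ for all $n$. * (A3) There are positive definite matrices $\Sigma_1,\Sigma_2$, each with pairwise distinct eigenvalues, such that $\operatorname{tr}\Sigma_2<\kappa^2\operatorname{tr}\Sigma_1$, $\frac1n(\mathbf B^*)^\top\mathbf B^*\to\Sigma_1$ and $\frac1{na_n}(\mathbf A^*)^\top\mathbf A^*\to\Sigma_2$. * (A5) There is $c_0>0$ such that $c_0^{-1}n^2a_n^2\le\|\mathbf S^*\|_0\le c_0n^2a_n^2$ for all sufficiently large $n$, where $\|\cdot\|_0$ counts the nonzero entries; and $C\sqrt{K_2}\,r_na_n^{-3/2}=o(s_{\min})$.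 * The thresholds $\eta_n>0$ satisfy $\eta_n=o(s_{\min})$ and $C\sqrt{K_2}\,r_na_n^{-3/2}=o(\eta_n)$. **Theorem.** There are universal constants $C_1,C_2,c>0$ such that, under these assumptions, for all sufficiently large $n$, with probability at least $1-C_1\exp(-C_2n)$, every minimizer $(\widehat{\mathbf B},\widehat{\mathbf A})$ satisfies $$\frac{\#\{(i,j):|\widehat s_{ij}|>\eta_n,\ s^*_{ij}=0\}}{\#\{(i,j):|\widehat s_{ij}|>\eta_n\}\vee1}\;\le\;c\,\frac{C^2K_2(K+2)\,G^2H^{-2}}{n\,a_n^3\,\eta_n^2}.$$ Moreover, after $c$ is replaced by a constant $c'>0$ that may depend on the model and on the sequences, but not on $n$, the same holds for all $n\ge1$. -/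

import Mathlib

open MeasureTheory ProbabilityTheory Filter Topology Asymptotics
open scoped Matrix

namespace SignedNetwork

noncomputable section

/-! ### The signed network model -/

/-- The values `-1` (negative edge), `0` (no edge) and `1` (positive edge) of an entry of the
adjacency matrix. -/
def support : Set ℤ := {-1, 0, 1}

/-- `F(t | x) = Pr(y ≥ t | x)`, with link function `f` and intercepts `d₀, d₁`. -/
def tailProb (f : ℝ → ℝ) (d₀ d₁ : ℝ) (t : ℤ) (x : ℝ) : ℝ :=
  if t ≤ -1 then 1
  else if t = 0 then f (d₀ + x)
  else if t = 1 then f (d₁ + x)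
  else 0

/-- `p(t | x) = F(t | x) - F(t + 1 | x)`, the probability of the value `t`. -/
def pointProb (f : ℝ → ℝ) (d₀ d₁ : ℝ) (t : ℤ) (x : ℝ) : ℝ :=
  tailProb f d₀ d₁ t x - tailProb f d₀ d₁ (t + 1) x

/-- A link function: increasing, with values in `[0, 1]`, and twice differentiable (so that the
first two derivatives of `p(t | ·)` exist). -/
structure IsLink (f : ℝ → ℝ) : Prop where
  monotone : Monotone f
  mem_Icc : ∀ x, f x ∈ Set.Icc (0 : ℝ) 1
  differentiable : Differentiable ℝ f
  differentiable_deriv : Differentiable ℝ (deriv f)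

/-- `Y` is the random adjacency matrix of a signed network on `n` nodes with underlying matrix
`M`: it is symmetric with values in `{-1, 0, 1}`, its entries on and above the diagonal are
mutually independent, and `Pr(Y i j ≥ t) = F(t | M i j)` for every `t`. -/
structure IsSignedNetwork (f : ℝ → ℝ) (d₀ d₁ : ℝ) {n : ℕ} (M : Matrix (Fin n) (Fin n) ℝ)
    {Ω : Type*} [MeasurableSpace Ω] (P : Measure Ω) (Y : Ω → Matrix (Fin n) (Fin n) ℤ) :
    Prop where
  measurable : ∀ i j, Measurable fun ω => Y ω i j
  mem_support : ∀ ω i j, Y ω i j ∈ support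
  symm : ∀ ω i j, Y ω i j = Y ω j i
  law : ∀ i j (t : ℤ), P.real {ω | t ≤ Y ω i j} = tailProb f d₀ d₁ t (M i j)
  indep : iIndepFun (fun (e : {e : Fin n × Fin n // e.1 ≤ e.2}) ω => Y ω e.1.1 e.1.2) P

/-! ### Embeddings and matrix norms -/

/-- The matrix `L` with entries `l_ij = -‖β_i - β_j‖²`, where `β_i` is the `i`-th row of `B`. -/
def balance {n k : ℕ} (B : Matrix (Fin n) (Fin k) ℝ) : Matrix (Fin n) (Fin n) ℝ :=
  Matrix.of fun i j => -∑ l, (B i l - B j l) ^ 2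

/-- The matrix `S = A Aᵀ`, with entries `s_ij = α_iᵀ α_j`. -/
def anomaly {n k : ℕ} (A : Matrix (Fin n) (Fin k) ℝ) : Matrix (Fin n) (Fin n) ℝ :=
  A * Aᵀ

/-- The Frobenius norm. -/
def frobeniusNorm {n k : ℕ} (X : Matrix (Fin n) (Fin k) ℝ) : ℝ :=
  √(∑ i, ∑ l, X i l ^ 2)

/-- The norm `‖X‖_{2→∞}`: the largest Euclidean norm of a row. -/
def twoInftyNorm {n k : ℕ} (X : Matrix (Fin n) (Fin k) ℝ) : ℝ :=
  ⨆ i, √(∑ l, X i l ^ 2)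

/-- `‖X‖₀`, the number of nonzero entries. -/
def zeroNorm {n : ℕ} (X : Matrix (Fin n) (Fin n) ℝ) : ℕ :=
  {e : Fin n × Fin n | X e.1 e.2 ≠ 0}.ncard

/-- The smallest absolute value of a nonzero entry (`0` if there is none). -/
def minSignal {n : ℕ} (X : Matrix (Fin n) (Fin n) ℝ) : ℝ :=
  sInf {r | ∃ i j, X i j ≠ 0 ∧ r = |X i j|}

/-- `1ᵀ B = 0`, `1ᵀ A = 0` and `Bᵀ A = 0`. -/
structure IsCentredOrthogonal {n K₁ K₂ : ℕ} (B : Matrix (Fin n) (Fin K₁) ℝ)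
    (A : Matrix (Fin n) (Fin K₂) ℝ) : Prop where
  sum_left : ∀ l, ∑ i, B i l = 0
  sum_right : ∀ l, ∑ i, A i l = 0
  orthogonal : Bᵀ * A = 0

/-! ### The estimator -/

/-- The log likelihood of the signed network `y` at `M`. -/
def logLik (f : ℝ → ℝ) (d₀ d₁ : ℝ) {n : ℕ} (y : Matrix (Fin n) (Fin n) ℤ)
    (M : Matrix (Fin n) (Fin n) ℝ) : ℝ :=
  ∑ i, ∑ j, Real.log (pointProb f d₀ d₁ (y i j) (M i j))

/-- The constraints of the estimation problem, with anomaly rate `a`. -/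
structure IsFeasible (C κ a : ℝ) {n K₁ K₂ : ℕ} (B : Matrix (Fin n) (Fin K₁) ℝ)
    (A : Matrix (Fin n) (Fin K₂) ℝ) : Prop where
  bound_left : twoInftyNorm B ≤ C
  bound_right : twoInftyNorm A ≤ C
  centred : IsCentredOrthogonal B A
  scale : frobeniusNorm A ≤ κ * √a * frobeniusNorm B

/-- `(B, A)` is a constrained maximum likelihood estimate: it minimizes minus the log likelihood
of `y` among all feasible pairs. -/
structure IsEstimate (f : ℝ → ℝ) (d₀ d₁ C κ a : ℝ) {n K₁ K₂ : ℕ}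
    (y : Matrix (Fin n) (Fin n) ℤ) (B : Matrix (Fin n) (Fin K₁) ℝ)
    (A : Matrix (Fin n) (Fin K₂) ℝ) : Prop where
  feasible : IsFeasible C κ a B A
  minimal : ∀ (B' : Matrix (Fin n) (Fin K₁) ℝ) (A' : Matrix (Fin n) (Fin K₂) ℝ),
    IsFeasible C κ a B' A' →
      -logLik f d₀ d₁ y (balance B + anomaly A) ≤ -logLik f d₀ d₁ y (balance B' + anomaly A')

/-- The false discovery proportion, relative to the true anomaly matrix `S`, of the hard
thresholding of `S'` at level `η`. -/
def fdp {n : ℕ} (S S' : Matrix (Fin n) (Fin n) ℝ) (η : ℝ) : ℝ :=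
  ({e : Fin n × Fin n | η < |S' e.1 e.2| ∧ S e.1 e.2 = 0}.ncard : ℝ) /
    max ({e : Fin n × Fin n | η < |S' e.1 e.2|}.ncard : ℝ) 1

/-! ### The constants `G_α`, `H_α` and the rate `r_n` -/

/-- The values `|p'(t | x)| / p(t | x)` with `t ∈ {-1, 0, 1}` and `|x| ≤ α`. -/
def steepnessSet (f : ℝ → ℝ) (d₀ d₁ α : ℝ) : Set ℝ :=
  {r | ∃ t ∈ support, ∃ x : ℝ, |x| ≤ α ∧
    r = |deriv (pointProb f d₀ d₁ t) x| / pointProb f d₀ d₁ t x}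

/-- The values `p'(t | x)² / p(t | x)² - p''(t | x) / p(t | x)` with `t ∈ {-1, 0, 1}` and
`|x| ≤ α`. -/
def curvatureSet (f : ℝ → ℝ) (d₀ d₁ α : ℝ) : Set ℝ :=
  {r | ∃ t ∈ support, ∃ x : ℝ, |x| ≤ α ∧
    r = deriv (pointProb f d₀ d₁ t) x ^ 2 / pointProb f d₀ d₁ t x ^ 2 -
      deriv (deriv (pointProb f d₀ d₁ t)) x / pointProb f d₀ d₁ t x}

/-- The constant `G_α`. -/
def steepness (f : ℝ → ℝ) (d₀ d₁ α : ℝ) : ℝ := sSup (steepnessSet f d₀ d₁ α)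

/-- The constant `H_α`. -/
def curvature (f : ℝ → ℝ) (d₀ d₁ α : ℝ) : ℝ := sInf (curvatureSet f d₀ d₁ α)

/-- `r_n = 4.02 √(2 (K + 2) / n) G / H` with `G = G_{5C² + d₀}`, `H = H_{5C² + d₀}` and
`K = K₁ + K₂`. -/
def rate (f : ℝ → ℝ) (d₀ d₁ C : ℝ) (K₁ K₂ n : ℕ) : ℝ :=
  4.02 * √(2 * ((K₁ : ℝ) + K₂ + 2) / n) * steepness f d₀ d₁ (5 * C ^ 2 + d₀) /
    curvature f d₀ d₁ (5 * C ^ 2 + d₀)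

/-! ### The conditions on the true parameters -/

/-- Bounded embeddings, `G_{5C² + d₀} < ∞` and `H_{5C² + d₀} > 0`. The positivity of `p` makes the
quotients in `G` and `H` meaningful; if `H` were an infimum over a set that is not bounded below,
its value here would be `0`. -/
structure ConditionA1 (f : ℝ → ℝ) (d₀ d₁ C : ℝ) {K₁ K₂ : ℕ}
    (B : ∀ n, Matrix (Fin n) (Fin K₁) ℝ) (A : ∀ n, Matrix (Fin n) (Fin K₂) ℝ) : Prop where
  bound_left : ∀ n, twoInftyNorm (B n) ≤ C
  bound_right : ∀ n, twoInftyNorm (A n) ≤ C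
  pos : ∀ t ∈ support, ∀ x : ℝ, |x| ≤ 5 * C ^ 2 + d₀ → 0 < pointProb f d₀ d₁ t x
  steepness_finite : BddAbove (steepnessSet f d₀ d₁ (5 * C ^ 2 + d₀))
  curvature_pos : 0 < curvature f d₀ d₁ (5 * C ^ 2 + d₀)

/-- The embedding vectors are centred, and the two embedding matrices are orthogonal. -/
def ConditionA2 {K₁ K₂ : ℕ} (B : ∀ n, Matrix (Fin n) (Fin K₁) ℝ)
    (A : ∀ n, Matrix (Fin n) (Fin K₂) ℝ) : Prop :=
  ∀ n, IsCentredOrthogonal (B n) (A n)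

/-- There are positive definite `Σ₁`, `Σ₂` with `tr Σ₂ < κ² tr Σ₁`, each with pairwise distinct
eigenvalues (listed here in strictly decreasing order), such that `BᵀB / n → Σ₁` and
`AᵀA / (n a_n) → Σ₂`. -/
def ConditionA3 (κ : ℝ) (a : ℕ → ℝ) {K₁ K₂ : ℕ} (B : ∀ n, Matrix (Fin n) (Fin K₁) ℝ)
    (A : ∀ n, Matrix (Fin n) (Fin K₂) ℝ) : Prop :=
  ∃ (S₁ : Matrix (Fin K₁) (Fin K₁) ℝ) (S₂ : Matrix (Fin K₂) (Fin K₂) ℝ)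
    (h₁ : S₁.PosDef) (h₂ : S₂.PosDef),
    S₂.trace < κ ^ 2 * S₁.trace ∧
    StrictAnti h₁.isHermitian.eigenvalues₀ ∧
    StrictAnti h₂.isHermitian.eigenvalues₀ ∧
    Tendsto (fun n : ℕ => (1 / (n : ℝ)) • ((B n)ᵀ * B n)) atTop (𝓝 S₁) ∧
    Tendsto (fun n : ℕ => (1 / ((n : ℝ) * a n)) • ((A n)ᵀ * A n)) atTop (𝓝 S₂)

/-- Sparsity (for all large `n`) and minimal signal strength of the true anomaly matrices. -/
structure ConditionA5 (f : ℝ → ℝ) (d₀ d₁ C : ℝ) (a : ℕ → ℝ) {K₁ K₂ : ℕ}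
    (A : ∀ n, Matrix (Fin n) (Fin K₂) ℝ) : Prop where
  sparsity : ∃ c₀ : ℝ, 0 < c₀ ∧ ∀ᶠ n : ℕ in atTop,
    c₀⁻¹ * (n : ℝ) ^ 2 * a n ^ 2 ≤ zeroNorm (anomaly (A n)) ∧
      (zeroNorm (anomaly (A n)) : ℝ) ≤ c₀ * (n : ℝ) ^ 2 * a n ^ 2
  signal : (fun n : ℕ => C * √(K₂ : ℝ) * rate f d₀ d₁ C K₁ K₂ n * a n ^ (-(3 / 2) : ℝ))
    =o[atTop] fun n => minSignal (anomaly (A n))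

/-- The right-hand side of the bound on the false discovery proportion, without the constant:
`C² K₂ (K + 2) G² H⁻² / (n a³ η²)`. -/
def fdpRate (f : ℝ → ℝ) (d₀ d₁ C : ℝ) (K₁ K₂ n : ℕ) (a η : ℝ) : ℝ :=
  C ^ 2 * K₂ * ((K₁ : ℝ) + K₂ + 2) * steepness f d₀ d₁ (5 * C ^ 2 + d₀) ^ 2 /
    curvature f d₀ d₁ (5 * C ^ 2 + d₀) ^ 2 / (n * a ^ 3 * η ^ 2)

end

end SignedNetwork

-- The estimation error is controlled in Frobenius norm; thresholding errors are then counted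
-- against it.
--
-- Likelihood. For large `n` the truth is feasible (`eventually_feasible`), so every minimizer has
-- at least its likelihood. As `log p(t | ·)` is `H`-strongly concave on the relevant range, the
-- error `Δ` of the underlying matrix satisfies `(H/2)‖Δ‖² ≤ ⟨score, Δ⟩` (`sum_sq_le_of_logLik_le`).
-- Since `Δ` has rank at most `2(K+2)`, the right side is at most the operator norm of the score
-- times `√(2(K+2)) ‖Δ‖` (`sum_mul_le_of_factor`). The score at the truth is symmetric with
-- independent, centred entries bounded by `G`, so its operator norm is at most `60 G √n` outside an
-- event of probability `exp(-n)` (`measure_score_ge`). Hence `‖Δ‖ ≤ 30 n r_n`.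
--
-- Separation. Double centring turns `L + S` into `2BBᵀ + S` without increasing norms. There `BᵀS =
-- 0`, `BBᵀ` is of order `n` on its column space, and `S` is only of order `n a_n`; a projection
-- argument (`anomaly_perturbation`) gives `‖Ŝ - S*‖ ≤ 90 n r_n`.
--
-- Counting. Each false discovery, and each missed nonzero entry, contributes at least `η²` to `‖Ŝ -
-- S*‖²`. At most half of the guaranteed number of nonzero entries can be missed, so the number of
-- discoveries is of order `n² a_n²` at least, and the proportion is at most a multiple of `c₀ r_n²
-- / (a_n² η²)`. This beats the claimed rate by a factor `a_n → 0`, which absorbs `c₀` and leaves a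
-- universal constant (`eventually_fdp_le`).

namespace SignedNetwork

-- Frobenius norm, projections, and perturbation of the decomposition `2BBᵀ + S`.

section Frobenius

open scoped Matrix.Norms.Frobenius

variable {ι ν κ : Type*} [Fintype ι] [Fintype ν] [Fintype κ]

lemma frobenius_sq (X : Matrix ι ν ℝ) : ‖X‖ ^ 2 = ∑ i, ∑ j, X i j ^ 2 := by
  have h : 0 ≤ ∑ i, ∑ j, X i j ^ 2 := by positivity
  rw [Matrix.frobenius_norm_def, ← Real.sqrt_eq_rpow]
  simp only [Real.rpow_two, Real.norm_eq_abs, sq_abs]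
  exact Real.sq_sqrt h

lemma frobenius_sq_eq_trace (X : Matrix ι ν ℝ) : ‖X‖ ^ 2 = (Xᵀ * X).trace := by
  rw [frobenius_sq, Finset.sum_comm]
  simp [Matrix.trace, Matrix.mul_apply, sq]

lemma sum_mul_le_frobenius (X Z : Matrix ι ν ℝ) : ∑ i, ∑ j, X i j * Z i j ≤ ‖X‖ * ‖Z‖ := by
  refine abs_le_of_sq_le_sq' ?_ (by positivity) |>.2
  rw [mul_pow, frobenius_sq, frobenius_sq]
  simp only [← Finset.sum_product', Finset.univ_product_univ]
  exact Finset.sum_mul_sq_le_sq_mul_sq _ _ _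

lemma trace_mul_le_frobenius (X Z : Matrix ι ν ℝ) : (Xᵀ * Z).trace ≤ ‖X‖ * ‖Z‖ := by
  refine le_trans (le_of_eq ?_) (sum_mul_le_frobenius X Z)
  rw [Finset.sum_comm]
  simp [Matrix.trace, Matrix.mul_apply]

/-- An orthogonal projection does not increase the Frobenius norm. -/
lemma frobenius_proj_mul_le [DecidableEq ι] {P : Matrix ι ι ℝ} (hs : Pᵀ = P) (hi : P * P = P)
    (Z : Matrix ι ν ℝ) : ‖P * Z‖ ≤ ‖Z‖ := by
  refine abs_le_of_sq_le_sq' ?_ (by positivity) |>.2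
  have h : ‖Z‖ ^ 2 = ‖P * Z‖ ^ 2 + ‖(1 - P) * Z‖ ^ 2 := by
    simp only [frobenius_sq_eq_trace, ← Matrix.trace_add, Matrix.transpose_mul, hs,
      Matrix.transpose_sub, Matrix.transpose_one, Matrix.mul_assoc]
    rw [← Matrix.mul_assoc P P, hi, ← Matrix.mul_assoc (1 - P) (1 - P)]
    have : (1 - P) * (1 - P) = 1 - P := by
      simp [Matrix.sub_mul, Matrix.mul_sub, hi]
    rw [this, ← Matrix.mul_add, ← Matrix.add_mul]
    simp
  nlinarith [sq_nonneg ‖(1 - P) * Z‖]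

lemma frobenius_mul_proj_le [DecidableEq ι] {P : Matrix ι ι ℝ} (hs : Pᵀ = P) (hi : P * P = P)
    (Z : Matrix ν ι ℝ) : ‖Z * P‖ ≤ ‖Z‖ := by
  rw [← Matrix.frobenius_norm_transpose (Z * P), ← Matrix.frobenius_norm_transpose Z,
    Matrix.transpose_mul, hs]
  exact frobenius_proj_mul_le hs hi _

lemma one_sub_proj [DecidableEq ι] {P : Matrix ι ι ℝ} (hs : Pᵀ = P) (hi : P * P = P) :
    (1 - P)ᵀ = 1 - P ∧ (1 - P) * (1 - P) = 1 - P := by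
  constructor
  · simp [hs]
  · simp [Matrix.sub_mul, Matrix.mul_sub, hi]

lemma sum_sq_eq_dotProduct (w : ι → ℝ) : ∑ i, w i ^ 2 = w ⬝ᵥ w := by simp [dotProduct, sq]

/-- A bound from below on a matrix, columnwise, gives the bound for the Frobenius norm. -/
lemma frobenius_mul_ge {B : Matrix ι κ ℝ} {σ : ℝ}
    (h : ∀ v : κ → ℝ, σ * ∑ l, v l ^ 2 ≤ ∑ i, (B *ᵥ v) i ^ 2) (V : Matrix κ ν ℝ) :
    σ * ‖V‖ ^ 2 ≤ ‖B * V‖ ^ 2 := by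
  rw [frobenius_sq, frobenius_sq, Finset.sum_comm, Finset.mul_sum,
    Finset.sum_comm (f := fun i j => (B * V) i j ^ 2)]
  exact Finset.sum_le_sum fun j _ => h fun l => V l j

/-- The orthogonal projection onto the column space of a matrix of full column rank. -/
lemma exists_colProj [DecidableEq ι] [DecidableEq κ] {B : Matrix ι κ ℝ} {σ : ℝ} (hσ : 0 < σ)
    (h : ∀ v : κ → ℝ, σ * ∑ l, v l ^ 2 ≤ ∑ i, (B *ᵥ v) i ^ 2) :
    ∃ P : Matrix ι ι ℝ, Pᵀ = P ∧ P * P = P ∧ P * B = B ∧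
      (∀ Z : Matrix ι ν ℝ, Bᵀ * Z = 0 → P * Z = 0) ∧
      ∀ Z : Matrix ι ν ℝ, σ * ‖P * Z‖ ≤ ‖B * Bᵀ * Z‖ := by
  have hinj : Function.Injective fun v => (Bᵀ * B) *ᵥ v := by
    intro v w hvw
    have h0 : (Bᵀ * B) *ᵥ (v - w) = 0 := by
      simp only at hvw
      rw [Matrix.mulVec_sub, hvw, sub_self]
    have h1 : ∑ i, (B *ᵥ (v - w)) i ^ 2 = 0 := by
      have : (v - w) ⬝ᵥ (Bᵀ * B) *ᵥ (v - w) = ∑ i, (B *ᵥ (v - w)) i ^ 2 := by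
        rw [← Matrix.mulVec_mulVec, Matrix.dotProduct_mulVec, Matrix.vecMul_transpose]
        simp [dotProduct, sq]
      rw [← this, h0, dotProduct_zero]
    have h2 := h (v - w)
    rw [h1] at h2
    have h3 : ∑ l, (v - w) l ^ 2 = 0 :=
      le_antisymm (by by_contra hc; push Not at hc; nlinarith) (by positivity)
    ext l
    have := (Finset.sum_eq_zero_iff_of_nonneg fun l _ => sq_nonneg _).1 h3 l (Finset.mem_univ _)
    simpa [sub_eq_zero] using this
  have hu : IsUnit (Bᵀ * B) := Matrix.mulVec_injective_iff_isUnit.1 hinj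
  have hd : IsUnit (Bᵀ * B).det := (Matrix.isUnit_iff_isUnit_det _).1 hu
  set H := (Bᵀ * B)⁻¹ with hH
  have hHs : Hᵀ = H := by
    rw [hH, Matrix.transpose_nonsing_inv, Matrix.transpose_mul, Matrix.transpose_transpose]
  have hH1 : H * (Bᵀ * B) = 1 := Matrix.nonsing_inv_mul _ hd
  have hH2 : (Bᵀ * B) * H = 1 := Matrix.mul_nonsing_inv _ hd
  refine ⟨B * H * Bᵀ, ?_, ?_, ?_, ?_, ?_⟩
  · simp [Matrix.transpose_mul, hHs, Matrix.mul_assoc]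
  · calc B * H * Bᵀ * (B * H * Bᵀ) = B * (H * (Bᵀ * B)) * H * Bᵀ := by
          simp only [Matrix.mul_assoc]
      _ = _ := by rw [hH1, Matrix.mul_one]
  · rw [Matrix.mul_assoc, Matrix.mul_assoc, hH1, Matrix.mul_one]
  · intro Z hZ
    rw [Matrix.mul_assoc, hZ, Matrix.mul_zero]
  · intro Z
    set V := H * (Bᵀ * Z) with hV
    have hW : B * H * Bᵀ * Z = B * V := by simp only [hV, Matrix.mul_assoc]
    have hBW : Bᵀ * (B * V) = Bᵀ * Z := by
      rw [← Matrix.mul_assoc, hV, ← Matrix.mul_assoc, hH2, Matrix.one_mul]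
    rw [hW, Matrix.mul_assoc, ← hBW]
    set W := B * V with hWd
    -- Chain: `σ‖V‖² ≤ ‖W‖² ≤ ‖V‖ ‖BᵀW‖` gives `σ‖W‖² ≤ ‖BᵀW‖²`, and `‖BᵀW‖² ≤ ‖W‖ ‖BBᵀW‖`; then
    -- `‖W‖` cancels.
    have h1 : σ * ‖V‖ ^ 2 ≤ ‖W‖ ^ 2 := frobenius_mul_ge h V
    have h2 : ‖W‖ ^ 2 ≤ ‖V‖ * ‖Bᵀ * W‖ := by
      rw [frobenius_sq_eq_trace]
      nth_rewrite 1 [hWd]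
      rw [Matrix.transpose_mul, Matrix.mul_assoc]
      exact trace_mul_le_frobenius _ _
    have h3 : ‖Bᵀ * W‖ ^ 2 ≤ ‖W‖ * ‖B * (Bᵀ * W)‖ := by
      rw [frobenius_sq_eq_trace]
      nth_rewrite 1 [Matrix.transpose_mul]
      rw [Matrix.transpose_transpose, Matrix.mul_assoc]
      exact trace_mul_le_frobenius _ _
    rcases (norm_nonneg W).eq_or_lt with h0 | h0
    · rw [← h0, mul_zero]; positivity
    have h4 : σ * ‖W‖ ^ 2 ≤ ‖Bᵀ * W‖ ^ 2 := by
      have : ‖W‖ ^ 2 * (σ * ‖W‖ ^ 2) ≤ ‖W‖ ^ 2 * ‖Bᵀ * W‖ ^ 2 := by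
        calc ‖W‖ ^ 2 * (σ * ‖W‖ ^ 2) = σ * (‖W‖ ^ 2) ^ 2 := by ring
          _ ≤ σ * (‖V‖ * ‖Bᵀ * W‖) ^ 2 := by gcongr
          _ = σ * ‖V‖ ^ 2 * ‖Bᵀ * W‖ ^ 2 := by ring
          _ ≤ ‖W‖ ^ 2 * ‖Bᵀ * W‖ ^ 2 := by gcongr
      exact le_of_mul_le_mul_left this (by positivity)
    refine le_of_mul_le_mul_left (a := ‖W‖) ?_ h0
    nlinarith

/-- The form is a matrix inner product with `-wwᵀ`, whose Frobenius norm is `∑ wᵢ²`. -/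
lemma neg_quadForm_le (E : Matrix ι ι ℝ) (w : ι → ℝ) :
    -(w ⬝ᵥ E *ᵥ w) ≤ ‖E‖ * ∑ i, w i ^ 2 := by
  have e1 : -(w ⬝ᵥ E *ᵥ w) = ∑ i, ∑ j, E i j * (-(Matrix.vecMulVec w w)) i j := by
    simp only [dotProduct, Matrix.mulVec, Matrix.neg_apply, Matrix.vecMulVec_apply,
      Finset.mul_sum, ← Finset.sum_neg_distrib]
    refine Finset.sum_congr rfl fun i _ => Finset.sum_congr rfl fun j _ => by ring
  have e2 : ‖-(Matrix.vecMulVec w w)‖ = ∑ i, w i ^ 2 := by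
    rw [norm_neg]
    refine (sq_eq_sq₀ (norm_nonneg _) (by positivity)).1 ?_
    rw [frobenius_sq, sq (∑ i, w i ^ 2), Finset.sum_mul_sum]
    simp only [Matrix.vecMulVec_apply, mul_pow]
  rw [e1, ← e2]
  exact sum_mul_le_frobenius _ _

/-- If `B Bᵀ` and `B' B'ᵀ` are close and `B` is bounded below, then so is `B'`. -/
lemma lower_bound_of_close {B B' : Matrix ι κ ℝ} {σ : ℝ} (hσ : 0 < σ)
    (h : ∀ v : κ → ℝ, σ * ∑ l, v l ^ 2 ≤ ∑ i, (B *ᵥ v) i ^ 2)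
    (hclose : ‖B' * B'ᵀ - B * Bᵀ‖ ≤ σ / 2) (u : κ → ℝ) :
    σ / 2 * ∑ l, u l ^ 2 ≤ ∑ i, (B' *ᵥ u) i ^ 2 := by
  classical
  -- the quadratic form of `B' B'ᵀ` on the column space of `B`
  have key : ∀ v : κ → ℝ, σ / 2 * ∑ i, (B *ᵥ v) i ^ 2 ≤ ∑ l, (B'ᵀ *ᵥ (B *ᵥ v)) l ^ 2 := by
    intro v
    set w := B *ᵥ v with hw
    have a1 : σ * ∑ i, w i ^ 2 ≤ ∑ l, (Bᵀ *ᵥ w) l ^ 2 := by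
      have b1 := h v
      have b2 : ∑ i, w i ^ 2 = ∑ l, v l * (Bᵀ *ᵥ w) l := by
        rw [sum_sq_eq_dotProduct]
        nth_rewrite 1 [hw]
        rw [dotProduct_comm, Matrix.dotProduct_mulVec, ← Matrix.mulVec_transpose, dotProduct_comm]
        rfl
      have b3 : (∑ i, w i ^ 2) ^ 2 ≤ (∑ l, v l ^ 2) * ∑ l, (Bᵀ *ᵥ w) l ^ 2 := by
        rw [b2]; exact Finset.sum_mul_sq_le_sq_mul_sq _ _ _
      have hw0 : 0 ≤ ∑ i, w i ^ 2 := by positivity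
      have hb0 : 0 ≤ ∑ l, (Bᵀ *ᵥ w) l ^ 2 := by positivity
      rcases hw0.eq_or_lt with h0 | h0
      · rw [← h0, mul_zero]; exact hb0
      refine le_of_mul_le_mul_left (a := ∑ i, w i ^ 2) ?_ h0
      calc (∑ i, w i ^ 2) * (σ * ∑ i, w i ^ 2) = σ * (∑ i, w i ^ 2) ^ 2 := by ring
        _ ≤ σ * ((∑ l, v l ^ 2) * ∑ l, (Bᵀ *ᵥ w) l ^ 2) := by gcongr
        _ = (σ * ∑ l, v l ^ 2) * ∑ l, (Bᵀ *ᵥ w) l ^ 2 := by ring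
        _ ≤ _ := by gcongr
    have quad : ∀ X : Matrix ι κ ℝ, ∑ l, (Xᵀ *ᵥ w) l ^ 2 = w ⬝ᵥ (X * Xᵀ) *ᵥ w := by
      intro X
      rw [sum_sq_eq_dotProduct, ← Matrix.mulVec_mulVec, Matrix.dotProduct_mulVec w,
        Matrix.mulVec_transpose]
    have a2 : -(w ⬝ᵥ (B' * B'ᵀ - B * Bᵀ) *ᵥ w) ≤ σ / 2 * ∑ i, w i ^ 2 :=
      (neg_quadForm_le _ w).trans (by gcongr)
    rw [Matrix.sub_mulVec, dotProduct_sub, ← quad, ← quad] at a2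
    linarith
  have hinj : Function.Injective fun v => (B'ᵀ * B) *ᵥ v := by
    intro v w hvw
    have h0 : B'ᵀ *ᵥ (B *ᵥ (v - w)) = 0 := by
      simp only at hvw
      rw [Matrix.mulVec_mulVec, Matrix.mulVec_sub, hvw, sub_self]
    have h1 := key (v - w)
    have h2 := h (v - w)
    rw [h0] at h1
    simp only [Pi.zero_apply, ne_eq, OfNat.ofNat_ne_zero, not_false_eq_true, zero_pow,
      Finset.sum_const_zero] at h1
    have h3 : ∑ l, (v - w) l ^ 2 = 0 :=
      le_antisymm (by by_contra hc; push Not at hc; nlinarith [mul_pos hσ hc]) (by positivity)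
    ext l
    have := (Finset.sum_eq_zero_iff_of_nonneg fun l _ => sq_nonneg _).1 h3 l (Finset.mem_univ _)
    simpa [sub_eq_zero] using this
  have hu : IsUnit (B'ᵀ * B) := Matrix.mulVec_injective_iff_isUnit.1 hinj
  -- `B'ᵀB` is square and injective, so every `u` is `B'ᵀw` with `w = Bv`. Then `‖u‖² = ⟨B'u, w⟩ ≤
  -- ‖B'u‖ ‖w‖`, and `key` bounds `‖w‖` by `‖u‖`.
  obtain ⟨v, hv⟩ := Matrix.mulVec_surjective_iff_isUnit.2 hu u
  simp only [← Matrix.mulVec_mulVec] at hv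
  have h1 := key v
  rw [hv] at h1
  have h2 : ∑ l, u l ^ 2 = ∑ i, (B' *ᵥ u) i * (B *ᵥ v) i := by
    rw [sum_sq_eq_dotProduct]
    nth_rewrite 2 [← hv]
    rw [Matrix.dotProduct_mulVec, Matrix.vecMul_transpose]
    rfl
  have h3 : (∑ l, u l ^ 2) ^ 2 ≤ (∑ i, (B' *ᵥ u) i ^ 2) * ∑ i, (B *ᵥ v) i ^ 2 := by
    rw [h2]; exact Finset.sum_mul_sq_le_sq_mul_sq _ _ _
  have hu0 : 0 ≤ ∑ l, u l ^ 2 := by positivity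
  have hb0 : 0 ≤ ∑ i, (B' *ᵥ u) i ^ 2 := by positivity
  rcases hu0.eq_or_lt with h0 | h0
  · rw [← h0, mul_zero]; exact hb0
  refine le_of_mul_le_mul_left (a := ∑ l, u l ^ 2) ?_ h0
  nlinarith

/-- Stability of the second component of an orthogonal decomposition `2 B Bᵀ + S` with `B` bounded
below and `S` small. -/
theorem anomaly_perturbation [DecidableEq ι] {B B' : Matrix ι κ ℝ} {S S' : Matrix ι ι ℝ}
    {σ e d : ℝ} (hσ : 0 < σ) (h : ∀ v : κ → ℝ, σ * ∑ l, v l ^ 2 ≤ ∑ i, (B *ᵥ v) i ^ 2)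
    (hS : Sᵀ = S) (hS' : S'ᵀ = S') (hBS : Bᵀ * S = 0) (hBS' : B'ᵀ * S' = 0)
    (he : ‖S‖ ≤ e) (he' : ‖S'‖ ≤ e) (heσ : 3 * e ≤ σ) (hdσ : 3 * d ≤ σ)
    (hd : ‖(2 : ℝ) • (B' * B'ᵀ) + S' - ((2 : ℝ) • (B * Bᵀ) + S)‖ ≤ d) :
    ‖S' - S‖ ≤ 3 * d := by
  classical
  set D := (2 : ℝ) • (B' * B'ᵀ) + S' - ((2 : ℝ) • (B * Bᵀ) + S) with hD
  have hclose : ‖B' * B'ᵀ - B * Bᵀ‖ ≤ σ / 2 := by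
    have e1 : B' * B'ᵀ - B * Bᵀ = (1 / 2 : ℝ) • (D - S' + S) := by
      rw [hD]; module
    rw [e1, norm_smul, Real.norm_of_nonneg (by norm_num)]
    have := (norm_add_le (D - S') S).trans (add_le_add_left (norm_sub_le D S') _)
    linarith
  obtain ⟨P, hPs, hPi, hPB, hPz, hP⟩ := exists_colProj (ν := ι) hσ h
  obtain ⟨P', hPs', hPi', hPB', hPz', hP'⟩ :=
    exists_colProj (ν := ι) (half_pos hσ) (lower_bound_of_close hσ h hclose)
  set T := ‖S' - S‖ with hT
  have hBP : Bᵀ * P = Bᵀ := by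
    have := congrArg Matrix.transpose hPB
    rwa [Matrix.transpose_mul, hPs] at this
  -- The projections are mixed: `1 - P'` on the left kills `B'B'ᵀ` and `1 - P` on the right kills
  -- `BBᵀ`, so `D` and `S' - S` have the same compression. What remains are the cross terms `S'P`
  -- and `P'S`.
  have hPS : S' - S = (1 - P') * D * (1 - P) + (P * S')ᵀ - P' * S := by
    have e1 : (1 - P') * D * (1 - P) = (1 - P') * (S' - S) * (1 - P) := by
      have e2 : (1 - P') * (B' * B'ᵀ) = 0 := by
        rw [← Matrix.mul_assoc, Matrix.sub_mul, hPB', Matrix.one_mul, sub_self, Matrix.zero_mul]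
      have e3 : B * Bᵀ * (1 - P) = 0 := by
        rw [Matrix.mul_assoc, Matrix.mul_sub, hBP, Matrix.mul_one, sub_self, Matrix.mul_zero]
      have e4 : D = (2 : ℝ) • (B' * B'ᵀ) + (S' - S) - (2 : ℝ) • (B * Bᵀ) := by rw [hD]; abel
      rw [e4, Matrix.mul_sub (1 - P'), Matrix.mul_add, Matrix.mul_smul, e2, smul_zero, zero_add,
        Matrix.sub_mul,
        Matrix.mul_assoc (1 - P') ((2 : ℝ) • (B * Bᵀ)), Matrix.smul_mul, e3]
      simp
    have e5 : P' * S' = 0 := hPz' S' hBS'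
    have e6 : S * P = 0 := by
      have h6 := hPz S hBS
      have := congrArg Matrix.transpose h6
      rwa [Matrix.transpose_mul, hS, hPs, Matrix.transpose_zero] at this
    rw [e1, Matrix.transpose_mul, hS', hPs]
    have : (1 - P') * (S' - S) * (1 - P)
        = S' - S - (S' - S) * P - P' * (S' - S) + P' * (S' - S) * P := by noncomm_ring
    rw [this]
    have e7 : P' * (S' - S) = - (P' * S) := by rw [mul_sub, e5, zero_sub]
    have e8 : (S' - S) * P = S' * P := by rw [sub_mul, e6, sub_zero]
    rw [e7, e8, Matrix.neg_mul, Matrix.mul_assoc, e6, Matrix.mul_zero]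
    abel
  have b1 : ‖(1 - P') * D * (1 - P)‖ ≤ d := by
    have q := one_sub_proj hPs hPi
    have q' := one_sub_proj hPs' hPi'
    exact (frobenius_mul_proj_le q.1 q.2 _).trans ((frobenius_proj_mul_le q'.1 q'.2 _).trans hd)
  -- As `B'ᵀS' = 0`, `2BBᵀS'` equals `(2BBᵀ - 2B'B'ᵀ)S'`, a product of two controlled factors: the
  -- cross term is of second order.
  have b2 : 2 * σ * ‖P * S'‖ ≤ e * (T + d) := by
    have e1 : (2 : ℝ) • (B * Bᵀ * S') = ((S' - S) - D) * S' := by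
      have : (S' - S) - D = (2 : ℝ) • (B * Bᵀ) - (2 : ℝ) • (B' * B'ᵀ) := by rw [hD]; abel
      rw [this, sub_mul, Matrix.smul_mul, Matrix.smul_mul, Matrix.mul_assoc B', hBS']
      simp
    have e2 : 2 * ‖B * Bᵀ * S'‖ = ‖((S' - S) - D) * S'‖ := by
      rw [← e1, norm_smul, Real.norm_of_nonneg (by norm_num)]
    have e3 : ‖((S' - S) - D) * S'‖ ≤ (T + d) * e :=
      (Matrix.frobenius_norm_mul _ _).trans (mul_le_mul
        ((norm_sub_le _ _).trans (by gcongr)) he' (norm_nonneg _)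
        (add_nonneg (norm_nonneg _) ((norm_nonneg _).trans hd)))
    have := hP S'
    nlinarith
  have b3 : σ * ‖P' * S‖ ≤ e * (T + d) := by
    have e1 : (2 : ℝ) • (B' * B'ᵀ * S) = (D - (S' - S)) * S := by
      have : D - (S' - S) = (2 : ℝ) • (B' * B'ᵀ) - (2 : ℝ) • (B * Bᵀ) := by rw [hD]; abel
      rw [this, sub_mul, Matrix.smul_mul, Matrix.smul_mul, Matrix.mul_assoc B, hBS]
      simp
    have e2 : 2 * ‖B' * B'ᵀ * S‖ = ‖(D - (S' - S)) * S‖ := by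
      rw [← e1, norm_smul, Real.norm_of_nonneg (by norm_num)]
    have e3 : ‖(D - (S' - S)) * S‖ ≤ (d + T) * e :=
      (Matrix.frobenius_norm_mul _ _).trans (mul_le_mul
        ((norm_sub_le _ _).trans (by gcongr)) he (norm_nonneg _)
        (add_nonneg ((norm_nonneg _).trans hd) (norm_nonneg _)))
    have := hP' S
    nlinarith
  have b4 : T ≤ d + ‖P * S'‖ + ‖P' * S‖ := by
    rw [hT, hPS]
    refine (norm_sub_le _ _).trans (add_le_add_left ((norm_add_le _ _).trans ?_) _)
    rw [Matrix.frobenius_norm_transpose]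
    exact add_le_add_left b1 _
  have hTd : 0 ≤ T + d := add_nonneg (norm_nonneg _) ((norm_nonneg _).trans hd)
  -- The cross terms total at most `(3e / 2σ)(T + d) ≤ (T + d)/2`, so `T ≤ d + (T + d)/2`, that is,
  -- `T ≤ 3d`.
  have b5 : 3 * e * (T + d) ≤ σ * (T + d) := by gcongr
  have b6 : σ * T ≤ σ * (3 * d) := by
    nlinarith [mul_le_mul_of_nonneg_left b4 hσ.le]
  exact le_of_mul_le_mul_left b6 hσ

end Frobenius

-- Trace duality for matrices of low rank.

section LowRank

open scoped Matrix.Norms.Frobenius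

variable {ι τ : Type*} [Fintype ι] [Fintype τ]

/-- Duality between the operator norm and the Frobenius norm on matrices of low rank. -/
lemma sum_mul_le_of_factor {U : Matrix ι ι ℝ} {u : ℝ} (hu : 0 ≤ u)
    (hU : ∀ x y : ι → ℝ, ∑ i, ∑ j, x i * U i j * y j ≤ u * (√(∑ i, x i ^ 2) * √(∑ j, y j ^ 2)))
    (W : Matrix ι τ ℝ) (Z : Matrix τ ι ℝ) :
    ∑ i, ∑ j, U i j * (W * Z) i j ≤ u * √(Fintype.card τ : ℝ) * ‖W * Z‖ := by
  classical
  let wcol : τ → EuclideanSpace ℝ ι := fun t => WithLp.toLp 2 fun i => W i t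
  -- In an orthonormal basis `b` of the column span, `WZ = ∑ bₖ cₖᵀ` with `∑ ‖cₖ‖² = ‖WZ‖²`. Each
  -- rank-one term costs `u‖cₖ‖`, and Cauchy–Schwarz over the at most `card τ` terms gives the
  -- square root.
  let V : Submodule ℝ (EuclideanSpace ℝ ι) := Submodule.span ℝ (Set.range wcol)
  let b := stdOrthonormalBasis ℝ V
  let col : ι → EuclideanSpace ℝ ι := fun j => WithLp.toLp 2 fun i => (W * Z) i j
  have hcol : ∀ j, col j ∈ V := by
    intro j
    have : col j = ∑ t, Z t j • wcol t := by
      ext i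
      simp [col, wcol, Matrix.mul_apply, mul_comm]
    rw [this]
    exact Submodule.sum_mem _ fun t _ =>
      Submodule.smul_mem _ _ (Submodule.subset_span (Set.mem_range_self t))
  let c : Fin (Module.finrank ℝ V) → ι → ℝ := fun k j => (b.repr ⟨col j, hcol j⟩) k
  have hexp : ∀ i j, (W * Z) i j = ∑ k, c k j * (b k : EuclideanSpace ℝ ι) i := by
    intro i j
    have h1 := congrArg (fun v : V => (v : EuclideanSpace ℝ ι) i) (b.sum_repr ⟨col j, hcol j⟩)
    simp only [AddSubmonoidClass.coe_finsetSum, WithLp.ofLp_sum, Finset.sum_apply] at h1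
    exact h1.symm
  have hb : ∀ k, ∑ i, (b k : EuclideanSpace ℝ ι) i ^ 2 = 1 := by
    intro k
    have h1 : ‖(b k : EuclideanSpace ℝ ι)‖ = 1 := b.orthonormal.1 k
    rw [EuclideanSpace.norm_eq, Real.sqrt_eq_one] at h1
    simpa using h1
  have hc : ∑ k, ∑ j, c k j ^ 2 = ‖W * Z‖ ^ 2 := by
    rw [frobenius_sq, Finset.sum_comm, Finset.sum_comm (f := fun i j => (W * Z) i j ^ 2)]
    refine Finset.sum_congr rfl fun j _ => ?_
    have h1 : ‖b.repr ⟨col j, hcol j⟩‖ = ‖col j‖ := b.repr.norm_map _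
    rw [EuclideanSpace.norm_eq, EuclideanSpace.norm_eq,
      Real.sqrt_inj (by positivity) (by positivity)] at h1
    simpa [c, col] using h1
  have hr : (Module.finrank ℝ V : ℝ) ≤ Fintype.card τ := by
    exact_mod_cast finrank_range_le_card wcol
  calc ∑ i, ∑ j, U i j * (W * Z) i j
      = ∑ k, ∑ i, ∑ j, (b k : EuclideanSpace ℝ ι) i * U i j * c k j := by
        symm
        rw [Finset.sum_comm]
        refine Finset.sum_congr rfl fun i _ => ?_
        rw [Finset.sum_comm]
        refine Finset.sum_congr rfl fun j _ => ?_
        rw [hexp, Finset.mul_sum]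
        exact Finset.sum_congr rfl fun k _ => by ring
    _ ≤ ∑ k, u * √(∑ j, c k j ^ 2) := by
        refine Finset.sum_le_sum fun k _ => (hU _ _).trans (le_of_eq ?_)
        rw [hb, Real.sqrt_one, one_mul]
    _ = u * ∑ k, 1 * √(∑ j, c k j ^ 2) := by rw [Finset.mul_sum]; simp
    _ ≤ u * (√(∑ k : Fin (Module.finrank ℝ V), (1 : ℝ) ^ 2) *
          √(∑ k, √(∑ j, c k j ^ 2) ^ 2)) := by
        gcongr
        exact Real.sum_mul_le_sqrt_mul_sqrt _ _ _
    _ = u * √(Module.finrank ℝ V : ℝ) * ‖W * Z‖ := by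
        have : ∀ k, √(∑ j, c k j ^ 2) ^ 2 = ∑ j, c k j ^ 2 := fun k =>
          Real.sq_sqrt (by positivity)
        simp only [this, hc, Real.sqrt_sq (norm_nonneg _)]
        simp [mul_assoc]
    _ ≤ _ := by gcongr

end LowRank

-- Rank of the underlying matrix.

section Factor

variable {n K₁ K₂ : ℕ}

/-- Left factor of `balance B + anomaly A`. -/
def leftFactor (B : Matrix (Fin n) (Fin K₁) ℝ) (A : Matrix (Fin n) (Fin K₂) ℝ) :
    Matrix (Fin n) (Fin 2 ⊕ Fin K₁ ⊕ Fin K₂) ℝ :=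
  Matrix.of fun i => Sum.elim ![-∑ l, B i l ^ 2, 1] (Sum.elim (B i) (A i))

/-- Right factor of `balance B + anomaly A`. -/
def rightFactor (B : Matrix (Fin n) (Fin K₁) ℝ) (A : Matrix (Fin n) (Fin K₂) ℝ) :
    Matrix (Fin 2 ⊕ Fin K₁ ⊕ Fin K₂) (Fin n) ℝ :=
  Matrix.of fun t j => Sum.elim ![1, -∑ l, B j l ^ 2] (Sum.elim (fun l => 2 * B j l) (A j)) t

/-- Expanding `-‖βᵢ - βⱼ‖²`, the two squared norms take one inner index each, the source of the 2 in
`K + 2`. -/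
lemma leftFactor_mul_rightFactor (B : Matrix (Fin n) (Fin K₁) ℝ) (A : Matrix (Fin n) (Fin K₂) ℝ) :
    leftFactor B A * rightFactor B A = balance B + anomaly A := by
  ext i j
  have h : ∑ l, (B i l - B j l) ^ 2
      = ∑ l, B i l ^ 2 + ∑ l, B j l ^ 2 - ∑ l, B i l * (2 * B j l) := by
    rw [← Finset.sum_add_distrib, ← Finset.sum_sub_distrib]
    exact Finset.sum_congr rfl fun l _ => by ring
  simp only [Matrix.mul_apply, Fintype.sum_sum_type, leftFactor, rightFactor, Matrix.of_apply,
    Sum.elim_inl, Sum.elim_inr, Fin.sum_univ_two, Matrix.cons_val_zero, Matrix.cons_val_one,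
    Matrix.add_apply, balance, anomaly, Matrix.transpose_apply, h]
  ring

end Factor

-- A lattice net for the operator norm.

section Concentration

variable {n : ℕ}

/-- A bilinear form bounded on the lattice points of a ball of radius `(5 / 2) √n` is bounded. -/
lemma bilin_le_of_lattice {U : Matrix (Fin n) (Fin n) ℝ} {M : ℝ} (hM : 0 ≤ M)
    (h : ∀ z w : Fin n → ℤ, ∑ i, z i ^ 2 ≤ 7 * n → ∑ i, w i ^ 2 ≤ 7 * n →
      ∑ i, ∑ j, (z i : ℝ) * U i j * w j ≤ M * n) (x y : Fin n → ℝ) :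
    ∑ i, ∑ j, x i * U i j * y j ≤ M * (√(∑ i, x i ^ 2) * √(∑ j, y j ^ 2)) := by
  classical
  rcases Nat.eq_zero_or_pos n with rfl | hn
  · simp
  have hn' : (0 : ℝ) < n := by exact_mod_cast hn
  let T : EuclideanSpace ℝ (Fin n) →L[ℝ] EuclideanSpace ℝ (Fin n) := Matrix.toEuclideanCLM (𝕜 := ℝ) U
  have hT : ∀ x y : EuclideanSpace ℝ (Fin n), inner ℝ (T y) x = ∑ i, ∑ j, x i * U i j * y j := by
    intro x y
    simp only [T, PiLp.inner_apply, Matrix.ofLp_toEuclideanCLM, Matrix.mulVec, dotProduct,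
      RCLike.inner_apply, conj_trivial, Finset.mul_sum, mul_assoc]
  have hle : ∀ x y : EuclideanSpace ℝ (Fin n), inner ℝ (T y) x ≤ ‖T‖ * ‖y‖ * ‖x‖ := fun x y =>
    (real_inner_le_norm _ _).trans (by gcongr; exact T.le_opNorm y)
  -- Unit vectors are scaled by `s = 2√n` and rounded to integers, with error at most `√n/2 = s/4`.
  -- The rounded points have squared norm at most `25n/4 ≤ 7n`. The error terms cost `(n + n +
  -- n/4)‖T‖`; division by `s² = 4n` gives `9/16 < 1`, so `‖T‖` can be absorbed.
  have hnorm : ‖T‖ ≤ M / 4 + 9 / 16 * ‖T‖ := by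
    refine ContinuousLinearMap.opNorm_le_of_re_inner_le (by positivity) fun y x hy hx => ?_
    -- rounding to the lattice
    obtain ⟨s, hs0, hs⟩ : ∃ s : ℝ, 0 ≤ s ∧ s ^ 2 = 4 * n :=
      ⟨2 * √n, by positivity, by rw [mul_pow, Real.sq_sqrt hn'.le]; norm_num⟩
    let rd : EuclideanSpace ℝ (Fin n) → Fin n → ℤ := fun v i => round (s * v i)
    let er : EuclideanSpace ℝ (Fin n) → EuclideanSpace ℝ (Fin n) := fun v =>
      WithLp.toLp 2 (fun i => (rd v i : ℝ)) - s • v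
    have her : ∀ v, ‖er v‖ ≤ s / 4 := by
      intro v
      rw [EuclideanSpace.norm_eq]
      refine Real.sqrt_le_iff.2 ⟨by positivity, ?_⟩
      calc ∑ i, ‖er v i‖ ^ 2 ≤ ∑ i : Fin n, (1 / 2 : ℝ) ^ 2 := by
            refine Finset.sum_le_sum fun i _ => ?_
            have := abs_sub_round (s * v i)
            rw [abs_sub_comm] at this
            have e : ‖er v i‖ = |(round (s * v i) : ℝ) - s * v i| := by
              simp [er, rd, Real.norm_eq_abs]
            rw [e]
            gcongr
        _ = (s / 4) ^ 2 := by
            rw [show (s / 4) ^ 2 = s ^ 2 / 16 by ring, hs]; simp; ring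
    have hlat : ∀ v, ‖v‖ = 1 → ∑ i, rd v i ^ 2 ≤ 7 * n := by
      intro v hv
      have h1 : ‖(WithLp.toLp 2 (fun i => (rd v i : ℝ)) : EuclideanSpace ℝ (Fin n))‖ ≤ 5 / 4 * s := by
        have : WithLp.toLp 2 (fun i => (rd v i : ℝ)) = er v + s • v := by simp [er]
        rw [this]
        refine (norm_add_le _ _).trans ?_
        rw [norm_smul, hv, Real.norm_of_nonneg hs0]
        linarith [her v]
      rw [EuclideanSpace.norm_eq, Real.sqrt_le_iff] at h1
      have h2 := h1.2
      rw [mul_pow, hs] at h2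
      simp only [Real.norm_eq_abs, sq_abs] at h2
      have : (∑ i, (rd v i : ℝ) ^ 2) ≤ 7 * n := h2.trans (by linarith)
      exact_mod_cast this
    have hz := h (rd x) (rd y) (hlat x hx) (hlat y hy)
    set z : EuclideanSpace ℝ (Fin n) := WithLp.toLp 2 (fun i => (rd x i : ℝ)) with hzd
    set w : EuclideanSpace ℝ (Fin n) := WithLp.toLp 2 (fun i => (rd y i : ℝ)) with hwd
    have hz' : inner ℝ (T w) z ≤ M * n := by rw [hT]; exact hz
    have hzx : z = s • x + er x := by simp [er, hzd]
    have hwy : w = s • y + er y := by simp [er, hwd]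
    rw [hzx, hwy, map_add, map_smul] at hz'
    simp only [inner_add_left, inner_add_right, real_inner_smul_left, real_inner_smul_right] at hz'
    have c1 := hle (er x) (-(s • y))
    have c2 := hle (-(s • x)) (er y)
    have c3 := hle (-(er x)) (er y)
    simp only [map_neg, map_smul, inner_neg_left, inner_neg_right, real_inner_smul_left,
      real_inner_smul_right, norm_neg, norm_smul, hx, hy, Real.norm_of_nonneg hs0, mul_one] at c1 c2 c3
    have hn4 : (n : ℝ) = s ^ 2 / 4 := by rw [hs]; ring
    have d1 : ‖T‖ * s * ‖er x‖ ≤ ‖T‖ * n := by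
      have : ‖T‖ * s * ‖er x‖ ≤ ‖T‖ * s * (s / 4) := by gcongr; exact her x
      rw [hn4]; linarith
    have d2 : ‖T‖ * ‖er y‖ * s ≤ ‖T‖ * n := by
      have : ‖T‖ * ‖er y‖ * s ≤ ‖T‖ * (s / 4) * s := by gcongr; exact her y
      rw [hn4]; linarith
    have d3 : ‖T‖ * ‖er y‖ * ‖er x‖ ≤ ‖T‖ * (n / 4) := by
      have : ‖T‖ * ‖er y‖ * ‖er x‖ ≤ ‖T‖ * (s / 4) * (s / 4) := by gcongr; exacts [her y, her x]
      rw [hn4]; linarith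
    have e : 4 * n * inner ℝ (T y) x ≤ 4 * n * (M / 4 + 9 / 16 * ‖T‖) := by
      rw [hn4] at hz' d1 d2 d3 ⊢; linarith
    exact le_of_mul_le_mul_left e (by positivity)
  have hTM : ‖T‖ ≤ M := by linarith
  have := hle (WithLp.toLp 2 x) (WithLp.toLp 2 y)
  rw [hT, EuclideanSpace.norm_eq, EuclideanSpace.norm_eq] at this
  simp only [Real.norm_eq_abs, sq_abs] at this
  refine this.trans ?_
  rw [mul_assoc, mul_comm √(∑ i, y i ^ 2)]
  gcongr

/-- The lattice points of a ball of radius of order `√n`. -/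
noncomputable def latticeBall (n : ℕ) : Finset (Fin n → ℤ) :=
  (Fintype.piFinset fun _ : Fin n => Finset.Icc (-(7 * n : ℤ)) (7 * n)).filter
    fun z => ∑ i, z i ^ 2 ≤ 7 * n

/-- The box only makes the set finite by construction: `|zᵢ| ≤ zᵢ² ≤ 7n` puts the ball inside it. -/
lemma mem_latticeBall {z : Fin n → ℤ} : z ∈ latticeBall n ↔ ∑ i, z i ^ 2 ≤ 7 * n := by
  simp only [latticeBall, Finset.mem_filter, Fintype.mem_piFinset, Finset.mem_Icc,
    and_iff_right_iff_imp]
  intro h i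
  have h1 : z i ^ 2 ≤ 7 * n :=
    (Finset.single_le_sum (f := fun i => z i ^ 2) (fun i _ => sq_nonneg _) (Finset.mem_univ i)).trans h
  constructor <;> nlinarith [Int.le_self_sq (z i), Int.le_self_sq (-z i)]

lemma sum_two_pow_neg_abs_le (m : ℕ) :
    ∑ k ∈ Finset.Icc (-(m : ℤ)) m, (1 / 2 : ℝ) ^ k.natAbs ≤ 3 := by
  have key : ∑ k ∈ Finset.Icc (-(m : ℤ)) m, (1 / 2 : ℝ) ^ k.natAbs = 3 - 2 * (1 / 2) ^ m := by
    induction m with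
    | zero => norm_num
    | succ m ih =>
      have : Finset.Icc (-((m + 1 : ℕ) : ℤ)) ((m + 1 : ℕ) : ℤ)
          = insert (-((m : ℤ) + 1)) (insert ((m : ℤ) + 1) (Finset.Icc (-(m : ℤ)) m)) := by
        ext k; simp only [Finset.mem_Icc, Finset.mem_insert]; push_cast; omega
      rw [this, Finset.sum_insert, Finset.sum_insert, ih]
      · have h1 : (-((m : ℤ) + 1)).natAbs = m + 1 := by omega
        have h2 : ((m : ℤ) + 1).natAbs = m + 1 := by omega
        rw [h1, h2, pow_succ]; ring
      · simp
      · simp only [Finset.mem_Icc, Finset.mem_insert]; omega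
  rw [key]
  have : (0 : ℝ) ≤ 2 * (1 / 2) ^ m := by positivity
  linarith

/-- Weigh `z` by `∏ 2^(-|zᵢ|)`. Since `∑ |zᵢ| ≤ ∑ zᵢ² ≤ 7n`, each point of the ball weighs at least
`2^(-7n)`, while the whole box weighs at most `3ⁿ`; and `384 = 3 · 2⁷`. -/
lemma card_latticeBall_le (n : ℕ) : ((latticeBall n).card : ℝ) ≤ 384 ^ n := by
  have h1 : ∀ z ∈ latticeBall n, (1 / 2 : ℝ) ^ (7 * n) ≤ ∏ i, (1 / 2 : ℝ) ^ (z i).natAbs := by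
    intro z hz
    rw [Finset.prod_pow_eq_pow_sum]
    refine pow_le_pow_of_le_one (by norm_num) (by norm_num) ?_
    have hz' := mem_latticeBall.1 hz
    have : ((∑ i, (z i).natAbs : ℕ) : ℤ) ≤ 7 * n := by
      push_cast
      refine le_trans (Finset.sum_le_sum fun i _ => ?_) hz'
      rw [← sq_abs]
      exact Int.le_self_sq _
    exact_mod_cast this
  have h2 : ((latticeBall n).card : ℝ) * (1 / 2) ^ (7 * n) ≤ 3 ^ n := by
    calc ((latticeBall n).card : ℝ) * (1 / 2) ^ (7 * n)
        = ∑ z ∈ latticeBall n, (1 / 2 : ℝ) ^ (7 * n) := by simp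
      _ ≤ ∑ z ∈ latticeBall n, ∏ i, (1 / 2 : ℝ) ^ (z i).natAbs := Finset.sum_le_sum h1
      _ ≤ ∑ z ∈ Fintype.piFinset fun _ : Fin n => Finset.Icc (-(7 * n : ℤ)) (7 * n),
            ∏ i, (1 / 2 : ℝ) ^ (z i).natAbs :=
          Finset.sum_le_sum_of_subset_of_nonneg (Finset.filter_subset _ _)
            fun _ _ _ => by positivity
      _ = ∏ i : Fin n, ∑ k ∈ Finset.Icc (-(7 * n : ℤ)) (7 * n), (1 / 2 : ℝ) ^ k.natAbs :=
          by rw [Finset.prod_univ_sum]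
      _ ≤ ∏ i : Fin n, (3 : ℝ) :=
          Finset.prod_le_prod (fun _ _ => by positivity) fun _ _ => by
            have := sum_two_pow_neg_abs_le (7 * n)
            push_cast at this
            exact this
      _ = 3 ^ n := by simp
  calc ((latticeBall n).card : ℝ)
      = ((latticeBall n).card : ℝ) * (1 / 2) ^ (7 * n) * (2 ^ 7) ^ n := by
        rw [mul_assoc, pow_mul, ← mul_pow]; norm_num
    _ ≤ 3 ^ n * (2 ^ 7) ^ n := by gcongr
    _ = 384 ^ n := by rw [← mul_pow]; norm_num

end Concentration

-- Operator norm of a symmetric random matrix.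

section Hoeffding

variable {n : ℕ}

/-- Only the entries with `i ≤ j` are independent, so each off-diagonal pair must be merged into a
single summand. -/
lemma sum_eq_sum_upper (g : Fin n → Fin n → ℝ) :
    ∑ i, ∑ j, g i j = ∑ e : {e : Fin n × Fin n // e.1 ≤ e.2},
      (g e.1.1 e.1.2 + if e.1.1 < e.1.2 then g e.1.2 e.1.1 else 0) := by
  have h1 : ∑ e : {e : Fin n × Fin n // e.1 ≤ e.2},
      (g e.1.1 e.1.2 + if e.1.1 < e.1.2 then g e.1.2 e.1.1 else 0)
      = ∑ e : Fin n × Fin n, if e.1 ≤ e.2 then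
          (g e.1 e.2 + if e.1 < e.2 then g e.2 e.1 else 0) else 0 := by
    rw [← Finset.sum_filter]
    exact (Finset.sum_subtype _ (by simp)
      (fun e : Fin n × Fin n => g e.1 e.2 + if e.1 < e.2 then g e.2 e.1 else 0)).symm
  have h2 : ∑ e : Fin n × Fin n, (if e.1 ≤ e.2 then
          (g e.1 e.2 + if e.1 < e.2 then g e.2 e.1 else 0) else 0)
      = ∑ i, ∑ j, (if i ≤ j then g i j else 0) + ∑ i, ∑ j, (if i < j then g j i else 0) := by
    rw [← Finset.univ_product_univ, Finset.sum_product, ← Finset.sum_add_distrib]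
    refine Finset.sum_congr rfl fun i _ => ?_
    rw [← Finset.sum_add_distrib]
    refine Finset.sum_congr rfl fun j _ => ?_
    by_cases h : i ≤ j
    · simp [h]
    · simp [h, not_lt.2 (not_le.1 h).le]
  rw [h1, h2, Finset.sum_comm (f := fun i j => if i < j then g j i else 0),
    ← Finset.sum_add_distrib]
  refine Finset.sum_congr rfl fun i _ => ?_
  rw [← Finset.sum_add_distrib]
  refine Finset.sum_congr rfl fun j _ => ?_
  by_cases h : i ≤ j
  · simp [h, not_lt.2 h]
  · simp [h, not_le.1 h]

variable {Ω : Type*} [MeasurableSpace Ω] {P : Measure Ω}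

lemma hasSubgaussianMGF_mono {X : Ω → ℝ} {c c' : NNReal} (h : HasSubgaussianMGF X c P)
    (hc : c ≤ c') : HasSubgaussianMGF X c' P :=
  ⟨h.1, fun t => (h.2 t).trans (Real.exp_le_exp.2 (by gcongr))⟩

variable [IsProbabilityMeasure P] {U : Ω → Matrix (Fin n) (Fin n) ℝ} {G : ℝ}

/-- Hoeffding's inequality for a bilinear form in a symmetric random matrix. -/
lemma measure_bilin_ge_le (hG : 0 ≤ G) (hm : ∀ i j, Measurable fun ω => U ω i j)
    (hs : ∀ ω i j, U ω i j = U ω j i) (hb : ∀ ω i j, |U ω i j| ≤ G)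
    (h0 : ∀ i j, ∫ ω, U ω i j ∂P = 0)
    (hind : iIndepFun (fun (e : {e : Fin n × Fin n // e.1 ≤ e.2}) ω => U ω e.1.1 e.1.2) P)
    (x y : Fin n → ℝ) {v ε : ℝ} (hv : 2 * ((∑ i, x i ^ 2) * ∑ j, y j ^ 2) * G ^ 2 ≤ v)
    (hε : 0 ≤ ε) :
    P.real {ω | ε ≤ ∑ i, ∑ j, x i * U ω i j * y j} ≤ Real.exp (-ε ^ 2 / (2 * v)) := by
  let wt : {e : Fin n × Fin n // e.1 ≤ e.2} → ℝ := fun e =>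
    x e.1.1 * y e.1.2 + if e.1.1 < e.1.2 then x e.1.2 * y e.1.1 else 0
  have hsum : ∀ ω, ∑ i, ∑ j, x i * U ω i j * y j
      = ∑ e : {e : Fin n × Fin n // e.1 ≤ e.2}, wt e * U ω e.1.1 e.1.2 := by
    intro ω
    rw [sum_eq_sum_upper]
    refine Finset.sum_congr rfl fun e _ => ?_
    by_cases h : e.1.1 < e.1.2
    · simp only [wt, h, if_true, hs ω e.1.2 e.1.1]; ring
    · simp only [wt, h, if_false]; ring
  -- The factor 2 is the price of symmetry: `(p + q)² ≤ 2p² + 2q²` for each merged pair.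
  have hwt : ∑ e, wt e ^ 2 ≤ 2 * ((∑ i, x i ^ 2) * ∑ j, y j ^ 2) := by
    rw [Finset.sum_mul_sum, sum_eq_sum_upper, Finset.mul_sum]
    refine Finset.sum_le_sum fun e _ => ?_
    by_cases h : e.1.1 < e.1.2
    · simp only [wt, h, if_true]
      nlinarith [sq_nonneg (x e.1.1 * y e.1.2 - x e.1.2 * y e.1.1)]
    · simp only [wt, h, if_false]
      nlinarith [sq_nonneg (x e.1.1 * y e.1.2)]
  have hsub : ∀ e : {e : Fin n × Fin n // e.1 ≤ e.2}, HasSubgaussianMGF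
      (fun ω => wt e * U ω e.1.1 e.1.2) (⟨wt e ^ 2, sq_nonneg _⟩ * (‖G - -G‖₊ / 2) ^ 2) P :=
    fun e => (hasSubgaussianMGF_of_mem_Icc_of_integral_eq_zero (hm _ _).aemeasurable
      (ae_of_all _ fun ω => abs_le.1 (hb ω _ _)) (h0 _ _)).const_mul _
  have htot := HasSubgaussianMGF.sum_of_iIndepFun (s := Finset.univ)
    (hind.comp (fun e (u : ℝ) => wt e * u) fun e => measurable_const_mul _) (fun e _ => hsub e)
  have hv0 : 0 ≤ v := le_trans (by positivity) hv
  have hle : ∑ e : {e : Fin n × Fin n // e.1 ≤ e.2},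
      (NNReal.mk (wt e ^ 2) (sq_nonneg _) * ((‖G - -G‖₊ / 2) ^ 2 : NNReal)) ≤ NNReal.mk v hv0 := by
    rw [← Finset.sum_mul, ← NNReal.coe_le_coe]
    simp only [NNReal.coe_mul, NNReal.coe_sum, NNReal.coe_mk, NNReal.coe_pow, NNReal.coe_div,
      coe_nnnorm, NNReal.coe_ofNat]
    have hG2 : ‖G - -G‖ / 2 = G := by
      rw [sub_neg_eq_add, Real.norm_of_nonneg (by linarith)]; ring
    rw [hG2]
    exact le_trans (mul_le_mul_of_nonneg_right hwt (sq_nonneg G)) hv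
  simp only [hsum]
  exact (hasSubgaussianMGF_mono htot hle).measure_ge_le hε

/-- The operator norm of a symmetric random matrix with independent centred bounded entries. -/
theorem measure_bilin_le_ge (hG : 0 < G) (hm : ∀ i j, Measurable fun ω => U ω i j)
    (hs : ∀ ω i j, U ω i j = U ω j i) (hb : ∀ ω i j, |U ω i j| ≤ G)
    (h0 : ∀ i j, ∫ ω, U ω i j ∂P = 0)
    (hind : iIndepFun (fun (e : {e : Fin n × Fin n // e.1 ≤ e.2}) ω => U ω e.1.1 e.1.2) P) :
    1 - Real.exp (-n) ≤ P.real {ω | ∀ x y : Fin n → ℝ, ∑ i, ∑ j, x i * U ω i j * y j ≤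
      60 * G * √n * (√(∑ i, x i ^ 2) * √(∑ j, y j ^ 2))} := by
  rcases Nat.eq_zero_or_pos n with rfl | hn
  · simp
  have hn' : (0 : ℝ) < n := by exact_mod_cast hn
  set M := 60 * G * √n with hM
  have hM0 : 0 ≤ M := by positivity
  let bad : (Fin n → ℤ) × (Fin n → ℤ) → Set Ω := fun zw =>
    {ω | M * n ≤ ∑ i, ∑ j, (zw.1 i : ℝ) * U ω i j * zw.2 j}
  let N := latticeBall n
  -- Here `ε² / (2v) = 3600n / 196 ≥ 18n`. As `384 ≤ e⁶`, there are at most `e^(12n)` pairs, so the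
  -- union bound leaves `e^(-6n)`.
  have hbad : ∀ zw ∈ N ×ˢ N, P.real (bad zw) ≤ Real.exp (-(18 * n)) := by
    intro zw hzw
    rw [Finset.mem_product] at hzw
    have hz : ∀ z ∈ N, ∑ i, (z i : ℝ) ^ 2 ≤ 7 * n := fun z hz => by
      exact_mod_cast mem_latticeBall.1 hz
    refine (measure_bilin_ge_le hG.le hm hs hb h0 hind (fun i => (zw.1 i : ℝ))
      (fun i => (zw.2 i : ℝ)) (v := 2 * ((7 * n) * (7 * n)) * G ^ 2) (ε := M * n) ?_
      (by positivity)).trans ?_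
    · have := hz _ hzw.1
      have := hz _ hzw.2
      gcongr
    · rw [Real.exp_le_exp]
      have : (M * n) ^ 2 = 3600 * G ^ 2 * n ^ 3 := by
        rw [hM, mul_pow, mul_pow, mul_pow, Real.sq_sqrt hn'.le]; ring
      rw [neg_div, this, neg_le_neg_iff, le_div_iff₀ (by positivity)]
      have : 0 < G ^ 2 * (n : ℝ) ^ 3 := by positivity
      nlinarith
  have hunion : P.real (⋃ zw ∈ N ×ˢ N, bad zw) ≤ Real.exp (-n) := by
    refine (measureReal_biUnion_finset_le _ _).trans ((Finset.sum_le_sum hbad).trans ?_)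
    rw [Finset.sum_const, nsmul_eq_mul, Finset.card_product]
    push_cast
    have h1 : (N.card : ℝ) ≤ Real.exp (6 * n) := by
      refine (card_latticeBall_le n).trans ?_
      rw [mul_comm, Real.exp_nat_mul]
      refine pow_le_pow_left₀ (by norm_num) ?_ n
      have : Real.exp 6 = Real.exp 1 ^ 6 := by rw [← Real.exp_nat_mul]; norm_num
      rw [this]
      have := Real.exp_one_gt_d9
      calc (384 : ℝ) ≤ 2.7182 ^ 6 := by norm_num
        _ ≤ Real.exp 1 ^ 6 := by gcongr; linarith
    calc (N.card : ℝ) * N.card * Real.exp (-(18 * n))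
        ≤ Real.exp (6 * n) * Real.exp (6 * n) * Real.exp (-(18 * n)) := by gcongr
      _ = Real.exp (-(6 * n)) := by rw [← Real.exp_add, ← Real.exp_add]; ring_nf
      _ ≤ Real.exp (-n) := Real.exp_le_exp.2 (by linarith)
  -- Complementation is needed only for this finite union; the event in the statement, quantified
  -- over all real vectors, contains the complement, and monotonicity suffices.
  have hmeas : MeasurableSet (⋃ zw ∈ N ×ˢ N, bad zw) := by
    refine Finset.measurableSet_biUnion _ fun zw _ => measurableSet_le measurable_const ?_
    refine Finset.measurable_sum _ fun i _ => Finset.measurable_sum _ fun j _ => ?_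
    exact ((hm i j).const_mul _).mul_const _
  calc 1 - Real.exp (-n) ≤ 1 - P.real (⋃ zw ∈ N ×ˢ N, bad zw) := by linarith
    _ = P.real (⋃ zw ∈ N ×ˢ N, bad zw)ᶜ := (probReal_compl_eq_one_sub hmeas).symm
    _ ≤ _ := by
      refine measureReal_mono fun ω hω x y => bilin_le_of_lattice hM0 (fun z w hz hw => ?_) x y
      simp only [Set.mem_compl_iff, Set.mem_iUnion, not_exists] at hω
      have := hω (z, w) (Finset.mem_product.2 ⟨mem_latticeBall.2 hz, mem_latticeBall.2 hw⟩)
      exact (not_le.1 this).le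

end Hoeffding

-- Strong concavity of the log likelihood.

section Likelihood

variable {f : ℝ → ℝ} {d₀ d₁ α : ℝ}

lemma mem_support_iff {t : ℤ} : t ∈ support ↔ t = -1 ∨ t = 0 ∨ t = 1 := by
  simp [support]

lemma tailProb_differentiable (hf : IsLink f) (t : ℤ) :
    Differentiable ℝ (tailProb f d₀ d₁ t) ∧ Differentiable ℝ (deriv (tailProb f d₀ d₁ t)) := by
  have shift : ∀ d : ℝ, Differentiable ℝ (fun x => f (d + x)) ∧
      Differentiable ℝ (deriv fun x => f (d + x)) := by
    intro d
    have h : deriv (fun x => f (d + x)) = fun x => deriv f (d + x) :=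
      funext fun x => deriv_comp_const_add f d x
    have hd : Differentiable ℝ fun x : ℝ => d + x := by fun_prop
    exact ⟨hf.differentiable.comp hd, h ▸ hf.differentiable_deriv.comp hd⟩
  have const : ∀ c : ℝ, Differentiable ℝ (fun _ : ℝ => c) ∧
      Differentiable ℝ (deriv fun _ : ℝ => c) := by
    intro c
    simp
  by_cases h1 : t ≤ -1
  · have : tailProb f d₀ d₁ t = fun _ => 1 := by ext x; simp [tailProb, h1]
    rw [this]; exact const 1
  by_cases h2 : t = 0
  · have : tailProb f d₀ d₁ t = fun x => f (d₀ + x) := by ext x; simp [tailProb, h2]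
    rw [this]; exact shift d₀
  by_cases h3 : t = 1
  · have : tailProb f d₀ d₁ t = fun x => f (d₁ + x) := by ext x; simp [tailProb, h3]
    rw [this]; exact shift d₁
  · have : tailProb f d₀ d₁ t = fun _ => 0 := by ext x; simp [tailProb, h1, h2, h3]
    rw [this]; exact const 0

lemma pointProb_differentiable (hf : IsLink f) (t : ℤ) :
    Differentiable ℝ (pointProb f d₀ d₁ t) ∧ Differentiable ℝ (deriv (pointProb f d₀ d₁ t)) := by
  have h1 := tailProb_differentiable (d₀ := d₀) (d₁ := d₁) hf t
  have h2 := tailProb_differentiable (d₀ := d₀) (d₁ := d₁) hf (t + 1)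
  have e : pointProb f d₀ d₁ t = tailProb f d₀ d₁ t - tailProb f d₀ d₁ (t + 1) := rfl
  have e' : deriv (pointProb f d₀ d₁ t)
      = deriv (tailProb f d₀ d₁ t) - deriv (tailProb f d₀ d₁ (t + 1)) := by
    ext x; rw [e, deriv_sub (h1.1 x) (h2.1 x)]; rfl
  exact ⟨e ▸ h1.1.sub h2.1, e' ▸ h1.2.sub h2.2⟩

lemma sum_pointProb (x : ℝ) :
    pointProb f d₀ d₁ (-1) x + pointProb f d₀ d₁ 0 x + pointProb f d₀ d₁ 1 x = 1 := by
  simp [pointProb, tailProb]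

lemma sum_deriv_pointProb (hf : IsLink f) (x : ℝ) :
    deriv (pointProb f d₀ d₁ (-1)) x + deriv (pointProb f d₀ d₁ 0) x
      + deriv (pointProb f d₀ d₁ 1) x = 0 := by
  have h : ∀ t, DifferentiableAt ℝ (pointProb f d₀ d₁ t) x := fun t =>
    (pointProb_differentiable hf t).1 x
  rw [← deriv_add (h _) (h _), ← deriv_add ((h _).add (h _)) (h _)]
  have : pointProb f d₀ d₁ (-1) + pointProb f d₀ d₁ 0 + pointProb f d₀ d₁ 1 = fun _ => 1 :=
    funext fun x => sum_pointProb x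
  rw [this, deriv_const]

lemma steepness_bound (hbdd : BddAbove (steepnessSet f d₀ d₁ α)) {t : ℤ} (ht : t ∈ support) {x : ℝ}
    (hx : |x| ≤ α) :
    |deriv (pointProb f d₀ d₁ t) x| / pointProb f d₀ d₁ t x ≤ steepness f d₀ d₁ α :=
  le_csSup hbdd ⟨t, ht, x, hx, rfl⟩

/-- Positivity already yields boundedness below, because `sInf` of a set unbounded below is `0`. -/
lemma curvature_bound (hH : 0 < curvature f d₀ d₁ α) {t : ℤ} (ht : t ∈ support) {x : ℝ}
    (hx : |x| ≤ α) :
    curvature f d₀ d₁ α ≤ deriv (pointProb f d₀ d₁ t) x ^ 2 / pointProb f d₀ d₁ t x ^ 2 -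
      deriv (deriv (pointProb f d₀ d₁ t)) x / pointProb f d₀ d₁ t x := by
  have hbdd : BddBelow (curvatureSet f d₀ d₁ α) := by
    by_contra hc
    rw [curvature, Real.sInf_of_not_bddBelow hc] at hH
    exact lt_irrefl _ hH
  exact csInf_le hbdd ⟨t, ht, x, hx, rfl⟩

/-- Otherwise `p'(0 | ·)` vanishes on a neighbourhood of `0`, hence so does `p''(0 | 0)`, and the
curvature at `0` would be `0`. -/
lemma steepness_pos (hα : 0 < α) (hpos : ∀ t ∈ support, ∀ x : ℝ, |x| ≤ α → 0 < pointProb f d₀ d₁ t x)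
    (hbdd : BddAbove (steepnessSet f d₀ d₁ α)) (hH : 0 < curvature f d₀ d₁ α) :
    0 < steepness f d₀ d₁ α := by
  by_contra hc
  have ht : (0 : ℤ) ∈ support := by simp [support]
  have hz : ∀ x : ℝ, |x| ≤ α → deriv (pointProb f d₀ d₁ 0) x = 0 := by
    intro x hx
    have h1 := (steepness_bound hbdd ht hx).trans (not_lt.1 hc)
    rw [div_le_iff₀ (hpos 0 ht x hx), zero_mul] at h1
    exact abs_eq_zero.1 (le_antisymm h1 (abs_nonneg _))
  have hd : deriv (deriv (pointProb f d₀ d₁ 0)) 0 = 0 := by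
    have : deriv (pointProb f d₀ d₁ 0) =ᶠ[𝓝 0] fun _ => 0 := by
      filter_upwards [Icc_mem_nhds (neg_lt_zero.2 hα) hα] with x hx using hz x (abs_le.2 hx)
    rw [this.deriv_eq, deriv_const]
  have h0 : |(0 : ℝ)| ≤ α := by simpa using hα.le
  have := curvature_bound hH ht h0
  rw [hd, hz 0 h0] at this
  simp only [ne_eq, OfNat.ofNat_ne_zero, not_false_eq_true, zero_pow, zero_div, sub_zero] at this
  exact absurd hH (not_lt.2 this)

/-- Strong concavity of `log p(t | ·)`. -/
lemma log_pointProb_le (hf : IsLink f)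
    (hpos : ∀ t ∈ support, ∀ x : ℝ, |x| ≤ α → 0 < pointProb f d₀ d₁ t x)
    (hH : 0 < curvature f d₀ d₁ α) {t : ℤ} (ht : t ∈ support) {x y : ℝ} (hx : |x| ≤ α)
    (hy : |y| ≤ α) :
    Real.log (pointProb f d₀ d₁ t y) ≤ Real.log (pointProb f d₀ d₁ t x)
      + deriv (pointProb f d₀ d₁ t) x / pointProb f d₀ d₁ t x * (y - x)
      - curvature f d₀ d₁ α / 2 * (y - x) ^ 2 := by
  set p := pointProb f d₀ d₁ t with hp
  set H := curvature f d₀ d₁ α with hHd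
  obtain ⟨hd1, hd2⟩ := pointProb_differentiable (d₀ := d₀) (d₁ := d₁) hf t
  rw [← hp] at hd1 hd2
  have hpp : ∀ s ∈ Set.Icc (-α) α, 0 < p s := fun s hs => hpos t ht s (abs_le.2 hs)
  -- Adding `(H/2)s²` raises the second derivative of `log p` by `H`, to at most `0`. The claim is
  -- the tangent-line inequality for the concave `g`.
  let g : ℝ → ℝ := fun s => Real.log (p s) + H / 2 * s ^ 2
  have hg1 : ∀ s ∈ Set.Icc (-α) α, HasDerivAt g (deriv p s / p s + H * s) s := by
    intro s hs
    have h1 := ((hd1 s).hasDerivAt.log (hpp s hs).ne').add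
      ((hasDerivAt_pow 2 s).const_mul (H / 2))
    exact h1.congr_deriv (by simp; ring)
  have hg2 : ∀ s ∈ Set.Icc (-α) α, HasDerivAt (fun s => deriv p s / p s + H * s)
      ((deriv (deriv p) s * p s - deriv p s * deriv p s) / p s ^ 2 + H) s := by
    intro s hs
    have h1 := ((hd2 s).hasDerivAt.div (hd1 s).hasDerivAt (hpp s hs).ne').add
      ((hasDerivAt_id s).const_mul H)
    exact h1.congr_deriv (by simp)
  have hconc : ConcaveOn ℝ (Set.Icc (-α) α) g := by
    refine concaveOn_of_hasDerivWithinAt2_nonpos (convex_Icc _ _)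
      (f' := fun s => deriv p s / p s + H * s)
      (f'' := fun s => (deriv (deriv p) s * p s - deriv p s * deriv p s) / p s ^ 2 + H)
      (fun s hs => (hg1 s hs).continuousAt.continuousWithinAt)
      (fun s hs => (hg1 s (interior_subset hs)).hasDerivWithinAt)
      (fun s hs => (hg2 s (interior_subset hs)).hasDerivWithinAt) fun s hs => ?_
    have hs' := interior_subset hs
    have h1 := curvature_bound hH ht (abs_le.2 hs')
    rw [← hp, ← hHd] at h1
    have h2 : (deriv (deriv p) s * p s - deriv p s * deriv p s) / p s ^ 2
        = -(deriv p s ^ 2 / p s ^ 2 - deriv (deriv p) s / p s) := by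
      have := (hpp s hs').ne'
      field_simp
      ring
    rw [h2]; linarith
  have htan : g y ≤ g x + (deriv p x / p x + H * x) * (y - x) := by
    have hx' := abs_le.1 hx
    have hy' := abs_le.1 hy
    rcases lt_trichotomy x y with h | h | h
    · have h1 := hconc.slope_le_of_hasDerivAt hx' hy' h (hg1 x hx')
      rw [slope_def_field, div_le_iff₀ (sub_pos.2 h)] at h1
      linarith
    · simp [h]
    · have h1 := hconc.le_slope_of_hasDerivAt hy' hx' h (hg1 x hx')
      rw [slope_def_field, le_div_iff₀ (sub_pos.2 h)] at h1
      linarith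
  simp only [g] at htan
  nlinarith

/-- The entrywise derivative of the log likelihood. -/
noncomputable def score (f : ℝ → ℝ) (d₀ d₁ : ℝ) {n : ℕ} (y : Matrix (Fin n) (Fin n) ℤ)
    (M : Matrix (Fin n) (Fin n) ℝ) : Matrix (Fin n) (Fin n) ℝ :=
  Matrix.of fun i j => deriv (pointProb f d₀ d₁ (y i j)) (M i j) / pointProb f d₀ d₁ (y i j) (M i j)

variable {n : ℕ}

/-- The basic inequality of maximum likelihood estimation. -/
lemma sum_sq_le_of_logLik_le (hf : IsLink f)
    (hpos : ∀ t ∈ support, ∀ x : ℝ, |x| ≤ α → 0 < pointProb f d₀ d₁ t x)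
    (hH : 0 < curvature f d₀ d₁ α) {y : Matrix (Fin n) (Fin n) ℤ} (hy : ∀ i j, y i j ∈ support)
    {M M' : Matrix (Fin n) (Fin n) ℝ} (hM : ∀ i j, |M i j| ≤ α) (hM' : ∀ i j, |M' i j| ≤ α)
    (h : logLik f d₀ d₁ y M ≤ logLik f d₀ d₁ y M') :
    curvature f d₀ d₁ α / 2 * ∑ i, ∑ j, (M' - M) i j ^ 2
      ≤ ∑ i, ∑ j, score f d₀ d₁ y M i j * (M' - M) i j := by
  have h1 : logLik f d₀ d₁ y M' ≤ ∑ i, ∑ j, (Real.log (pointProb f d₀ d₁ (y i j) (M i j))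
      + score f d₀ d₁ y M i j * (M' - M) i j - curvature f d₀ d₁ α / 2 * (M' - M) i j ^ 2) :=
    Finset.sum_le_sum fun i _ => Finset.sum_le_sum fun j _ =>
      log_pointProb_le hf hpos hH (hy i j) (hM i j) (hM' i j)
  simp only [Finset.sum_sub_distrib, Finset.sum_add_distrib, ← Finset.mul_sum] at h1
  have h2 : logLik f d₀ d₁ y M
    = ∑ i, ∑ j, Real.log (pointProb f d₀ d₁ (y i j) (M i j)) := rfl
  linarith

end Likelihood

-- The score at the true parameter.

section Score

variable {f : ℝ → ℝ} {d₀ d₁ α : ℝ} {n : ℕ} {M : Matrix (Fin n) (Fin n) ℝ} {Ω : Type*}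
  [MeasurableSpace Ω] {P : Measure Ω} [IsProbabilityMeasure P]
  {Y : Ω → Matrix (Fin n) (Fin n) ℤ}

lemma measureReal_eq_pointProb (hY : IsSignedNetwork f d₀ d₁ M P Y) (i j : Fin n) (t : ℤ) :
    P.real {ω | Y ω i j = t} = pointProb f d₀ d₁ t (M i j) := by
  have h1 : {ω | Y ω i j = t} = {ω | t ≤ Y ω i j} \ {ω | t + 1 ≤ Y ω i j} := by
    ext ω; simp only [Set.mem_ofPred_eq, Set.mem_sdiff]; omega
  rw [h1, measureReal_sdiff _ (measurableSet_le measurable_const (hY.measurable i j)),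
    hY.law, hY.law, pointProb]
  intro ω; simp only [Set.mem_ofPred_eq]; omega

/-- The mean is `∑ₜ p · (p'/p) = ∑ₜ p'`, the derivative of the constant `1`. -/
lemma integral_score_eq_zero (hf : IsLink f) (hY : IsSignedNetwork f d₀ d₁ M P Y)
    (hpos : ∀ t ∈ support, ∀ x : ℝ, |x| ≤ α → 0 < pointProb f d₀ d₁ t x)
    (hM : ∀ i j, |M i j| ≤ α) (i j : Fin n) :
    ∫ ω, score f d₀ d₁ (Y ω) M i j ∂P = 0 := by
  let φ : ℤ → ℝ := fun t => deriv (pointProb f d₀ d₁ t) (M i j) / pointProb f d₀ d₁ t (M i j)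
  have hms : ∀ t, MeasurableSet {ω | Y ω i j = t} := fun t =>
    measurableSet_eq_fun (hY.measurable i j) measurable_const
  have h1 : ∀ ω, score f d₀ d₁ (Y ω) M i j = {ω | Y ω i j = -1}.indicator (fun _ => φ (-1)) ω
      + {ω | Y ω i j = 0}.indicator (fun _ => φ 0) ω
      + {ω | Y ω i j = 1}.indicator (fun _ => φ 1) ω := by
    intro ω
    have : score f d₀ d₁ (Y ω) M i j = φ (Y ω i j) := rfl
    rw [this]
    rcases mem_support_iff.1 (hY.mem_support ω i j) with h | h | h <;>
      simp [Set.indicator, h]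
  have hint : ∀ t, Integrable ({ω | Y ω i j = t}.indicator fun _ => φ t) P := fun t =>
    (integrable_const _).indicator (hms t)
  have h2 : (fun ω => score f d₀ d₁ (Y ω) M i j) = {ω | Y ω i j = -1}.indicator (fun _ => φ (-1))
      + {ω | Y ω i j = 0}.indicator (fun _ => φ 0) + {ω | Y ω i j = 1}.indicator (fun _ => φ 1) :=
    funext h1
  rw [h2, integral_add' ((hint _).add (hint _)) (hint _), integral_add' (hint _) (hint _)]
  simp only [integral_indicator_const _ (hms _), measureReal_eq_pointProb hY, smul_eq_mul, φ]
  have hne : ∀ t ∈ support, pointProb f d₀ d₁ t (M i j)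
      * (deriv (pointProb f d₀ d₁ t) (M i j) / pointProb f d₀ d₁ t (M i j))
      = deriv (pointProb f d₀ d₁ t) (M i j) := fun t ht =>
    mul_div_cancel₀ _ (hpos t ht _ (hM i j)).ne'
  rw [hne _ (by simp [support]), hne _ (by simp [support]), hne _ (by simp [support])]
  exact sum_deriv_pointProb hf _

/-- The operator norm of the score at the true parameter is of order `√n` with high probability. -/
theorem measure_score_ge (hf : IsLink f) (hY : IsSignedNetwork f d₀ d₁ M P Y)
    (hMs : ∀ i j, M i j = M j i)
    (hpos : ∀ t ∈ support, ∀ x : ℝ, |x| ≤ α → 0 < pointProb f d₀ d₁ t x)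
    (hbdd : BddAbove (steepnessSet f d₀ d₁ α)) (hG : 0 < steepness f d₀ d₁ α)
    (hM : ∀ i j, |M i j| ≤ α) :
    1 - Real.exp (-n) ≤ P.real {ω | ∀ x y : Fin n → ℝ,
      ∑ i, ∑ j, x i * score f d₀ d₁ (Y ω) M i j * y j ≤
        60 * steepness f d₀ d₁ α * √n * (√(∑ i, x i ^ 2) * √(∑ j, y j ^ 2))} := by
  have hmeas : ∀ e : Fin n × Fin n, Measurable fun t : ℤ =>
      deriv (pointProb f d₀ d₁ t) (M e.1 e.2) / pointProb f d₀ d₁ t (M e.1 e.2) :=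
    fun e => measurable_from_top
  refine measure_bilin_le_ge hG (fun i j => (hmeas (i, j)).comp (hY.measurable i j)) ?_ ?_
    (integral_score_eq_zero hf hY hpos hM) ?_
  · intro ω i j
    simp only [score, Matrix.of_apply, hY.symm ω i j, hMs i j]
  · intro ω i j
    simp only [score, Matrix.of_apply, abs_div]
    rw [abs_of_pos (hpos _ (hY.mem_support ω i j) _ (hM i j))]
    exact steepness_bound hbdd (hY.mem_support ω i j) (hM i j)
  · exact hY.indep.comp (fun e t => deriv (pointProb f d₀ d₁ t) (M e.1.1 e.1.2) /
      pointProb f d₀ d₁ t (M e.1.1 e.1.2)) fun e => hmeas e.1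

end Score

-- Deterministic bounds: estimation error and false discoveries.

section Deterministic

variable {n K₁ K₂ : ℕ}

lemma sum_row_sq_le {k : ℕ} {X : Matrix (Fin n) (Fin k) ℝ} {C : ℝ} (hC : 0 ≤ C)
    (h : twoInftyNorm X ≤ C) (i : Fin n) : ∑ l, X i l ^ 2 ≤ C ^ 2 :=
  (Real.sqrt_le_left hC).1 ((le_ciSup (Set.finite_range _).bddAbove i).trans h)

lemma abs_dot_le {k : ℕ} {v w : Fin k → ℝ} {C : ℝ} (hv : ∑ l, v l ^ 2 ≤ C ^ 2)
    (hw : ∑ l, w l ^ 2 ≤ C ^ 2) : |∑ l, v l * w l| ≤ C ^ 2 := by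
  refine abs_le_of_sq_le_sq ?_ (sq_nonneg C)
  calc (∑ l, v l * w l) ^ 2 ≤ (∑ l, v l ^ 2) * ∑ l, w l ^ 2 := Finset.sum_mul_sq_le_sq_mul_sq _ _ _
    _ ≤ C ^ 2 * C ^ 2 := by gcongr
    _ = (C ^ 2) ^ 2 := by ring

/-- The squared distance contributes at most `4C²` and the inner product at most `C²`. -/
lemma abs_entry_le {B : Matrix (Fin n) (Fin K₁) ℝ} {A : Matrix (Fin n) (Fin K₂) ℝ} {C : ℝ}
    (hC : 0 ≤ C) (hB : twoInftyNorm B ≤ C) (hA : twoInftyNorm A ≤ C) (i j : Fin n) :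
    |(balance B + anomaly A) i j| ≤ 5 * C ^ 2 := by
  have b1 := sum_row_sq_le hC hB i
  have b2 := sum_row_sq_le hC hB j
  have b3 := abs_le.1 (abs_dot_le b1 b2)
  have a3 := abs_le.1 (abs_dot_le (sum_row_sq_le hC hA i) (sum_row_sq_le hC hA j))
  have h : ∑ l, (B i l - B j l) ^ 2
      = ∑ l, B i l ^ 2 + ∑ l, B j l ^ 2 - 2 * ∑ l, B i l * B j l := by
    rw [Finset.mul_sum, ← Finset.sum_add_distrib, ← Finset.sum_sub_distrib]
    exact Finset.sum_congr rfl fun l _ => by ring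
  have h0 : 0 ≤ ∑ l, (B i l - B j l) ^ 2 := by positivity
  have e : (balance B + anomaly A) i j = -∑ l, (B i l - B j l) ^ 2 + ∑ l, A i l * A j l := by
    simp [balance, anomaly, Matrix.mul_apply]
  rw [e, abs_le]
  constructor <;> nlinarith

lemma anomaly_transpose (A : Matrix (Fin n) (Fin K₂) ℝ) : (anomaly A)ᵀ = anomaly A := by
  simp [anomaly, Matrix.transpose_mul]

lemma entry_symm (B : Matrix (Fin n) (Fin K₁) ℝ) (A : Matrix (Fin n) (Fin K₂) ℝ) (i j : Fin n) :
    (balance B + anomaly A) i j = (balance B + anomaly A) j i := by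
  have h1 : ∑ l, (B i l - B j l) ^ 2 = ∑ l, (B j l - B i l) ^ 2 :=
    Finset.sum_congr rfl fun l _ => by ring
  have h2 : anomaly A i j = anomaly A j i := congrFun (congrFun (anomaly_transpose A) j) i
  simp [balance, h1, h2]

open scoped Matrix.Norms.Frobenius

lemma frobeniusNorm_eq_norm {k : ℕ} (X : Matrix (Fin n) (Fin k) ℝ) : frobeniusNorm X = ‖X‖ := by
  rw [frobeniusNorm, ← frobenius_sq, Real.sqrt_sq (norm_nonneg _)]

lemma norm_sq_le_of_twoInftyNorm {k : ℕ} {X : Matrix (Fin n) (Fin k) ℝ} {C : ℝ} (hC : 0 ≤ C)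
    (h : twoInftyNorm X ≤ C) : ‖X‖ ^ 2 ≤ n * C ^ 2 := by
  rw [frobenius_sq]
  refine (Finset.sum_le_sum fun i _ => sum_row_sq_le hC h i).trans ?_
  simp

lemma norm_anomaly_le (A : Matrix (Fin n) (Fin K₂) ℝ) : ‖anomaly A‖ ≤ ‖A‖ ^ 2 := by
  refine (Matrix.frobenius_norm_mul _ _).trans (le_of_eq ?_)
  rw [Matrix.frobenius_norm_transpose, sq]

/-- The anomaly matrix of a feasible pair is small. -/
lemma IsFeasible.norm_anomaly_le {C κ a : ℝ} {B : Matrix (Fin n) (Fin K₁) ℝ}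
    {A : Matrix (Fin n) (Fin K₂) ℝ} (h : IsFeasible C κ a B A) (hC : 0 ≤ C) (ha : 0 ≤ a) :
    ‖anomaly A‖ ≤ κ ^ 2 * C ^ 2 * (n * a) := by
  have h1 := h.scale
  rw [frobeniusNorm_eq_norm, frobeniusNorm_eq_norm] at h1
  calc ‖anomaly A‖ ≤ ‖A‖ ^ 2 := SignedNetwork.norm_anomaly_le A
    _ ≤ (κ * √a * ‖B‖) ^ 2 := by gcongr
    _ = κ ^ 2 * a * ‖B‖ ^ 2 := by rw [mul_pow, mul_pow, Real.sq_sqrt ha]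
    _ ≤ κ ^ 2 * a * (n * C ^ 2) := by
      have := norm_sq_le_of_twoInftyNorm hC h.bound_left
      gcongr
    _ = _ := by ring

/-- The projection onto the orthogonal complement of the constant vectors. -/
noncomputable def centring (n : ℕ) : Matrix (Fin n) (Fin n) ℝ :=
  1 - (1 / (n : ℝ)) • Matrix.of fun _ _ => 1

lemma centring_mul {k : ℕ} (X : Matrix (Fin n) (Fin k) ℝ) (i : Fin n) (l : Fin k) :
    (centring n * X) i l = X i l - (1 / (n : ℝ)) * ∑ j, X j l := by
  rw [centring, Matrix.sub_mul, Matrix.one_mul, Matrix.smul_mul]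
  simp [Matrix.mul_apply]

lemma centring_transpose : (centring n)ᵀ = centring n := by
  ext i j
  simp [centring, Matrix.one_apply, eq_comm]

lemma centring_idem (hn : 0 < n) : centring n * centring n = centring n := by
  have hn' : (n : ℝ) ≠ 0 := by positivity
  ext i j
  rw [centring_mul]
  have : ∑ k, centring n k j = 0 := by
    simp [centring, Matrix.one_apply, Finset.sum_sub_distrib, hn']
  rw [this]; simp

/-- Double centring, as in multidimensional scaling: `-‖βᵢ - βⱼ‖²` is `2βᵢᵀβⱼ` minus `‖βᵢ‖²` and
`‖βⱼ‖²`. The last two form matrices `u1ᵀ` and `1uᵀ`, which centring kills, while it fixes the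
centred `B` and `A`. -/
lemma centring_sandwich (hn : 0 < n) {B : Matrix (Fin n) (Fin K₁) ℝ}
    {A : Matrix (Fin n) (Fin K₂) ℝ} (h : IsCentredOrthogonal B A) :
    centring n * (balance B + anomaly A) * centring n = (2 : ℝ) • (B * Bᵀ) + anomaly A := by
  have hn' : (n : ℝ) ≠ 0 := by positivity
  have hB : centring n * B = B := by
    ext i l; rw [centring_mul, h.sum_left]; simp
  have hA : centring n * A = A := by
    ext i l; rw [centring_mul, h.sum_right]; simp
  have hBt : Bᵀ * centring n = Bᵀ := by
    simpa [Matrix.transpose_mul, centring_transpose] using congrArg Matrix.transpose hB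
  have hAt : Aᵀ * centring n = Aᵀ := by
    simpa [Matrix.transpose_mul, centring_transpose] using congrArg Matrix.transpose hA
  let o : Matrix (Fin n) (Fin 1) ℝ := Matrix.of fun _ _ => 1
  let u : Matrix (Fin n) (Fin 1) ℝ := Matrix.of fun i _ => ∑ l, B i l ^ 2
  have ho : centring n * o = 0 := by
    ext i l; rw [centring_mul]; simp [o, hn']
  have hot : oᵀ * centring n = 0 := by
    simpa [Matrix.transpose_mul, centring_transpose] using congrArg Matrix.transpose ho
  have hbal : balance B = (2 : ℝ) • (B * Bᵀ) - u * oᵀ - o * uᵀ := by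
    ext i j
    have h : ∑ l, (B i l - B j l) ^ 2
        = ∑ l, B i l ^ 2 + ∑ l, B j l ^ 2 - 2 * ∑ l, B i l * B j l := by
      rw [Finset.mul_sum, ← Finset.sum_add_distrib, ← Finset.sum_sub_distrib]
      exact Finset.sum_congr rfl fun l _ => by ring
    simp only [balance, Matrix.of_apply, h, Matrix.sub_apply, Matrix.smul_apply, smul_eq_mul,
      Matrix.mul_apply, Matrix.transpose_apply, u, o, Finset.univ_unique, Finset.sum_const,
      Finset.card_singleton, one_smul]
    ring
  have e1 : centring n * (u * oᵀ) * centring n = 0 := by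
    rw [Matrix.mul_assoc, Matrix.mul_assoc u, hot]; simp
  have e2 : centring n * (o * uᵀ) * centring n = 0 := by
    rw [← Matrix.mul_assoc, ho]; simp
  have e3 : centring n * (B * Bᵀ) * centring n = B * Bᵀ := by
    rw [← Matrix.mul_assoc, hB, Matrix.mul_assoc, hBt]
  have e4 : centring n * anomaly A * centring n = anomaly A := by
    rw [anomaly, ← Matrix.mul_assoc, hA, Matrix.mul_assoc, hAt]
  rw [hbal, Matrix.mul_add, Matrix.add_mul, e4, Matrix.mul_sub, Matrix.mul_sub, Matrix.sub_mul,
    Matrix.sub_mul, e1, e2, Matrix.mul_smul, Matrix.smul_mul, e3]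
  simp

lemma norm_centred_diff_le (hn : 0 < n) {B B' : Matrix (Fin n) (Fin K₁) ℝ}
    {A A' : Matrix (Fin n) (Fin K₂) ℝ} (h : IsCentredOrthogonal B A)
    (h' : IsCentredOrthogonal B' A') :
    ‖(2 : ℝ) • (B' * B'ᵀ) + anomaly A' - ((2 : ℝ) • (B * Bᵀ) + anomaly A)‖
      ≤ ‖balance B' + anomaly A' - (balance B + anomaly A)‖ := by
  rw [← centring_sandwich hn h, ← centring_sandwich hn h', ← Matrix.sub_mul, ← Matrix.mul_sub]
  exact (frobenius_mul_proj_le centring_transpose (centring_idem hn) _).trans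
    (frobenius_proj_mul_le centring_transpose (centring_idem hn) _)

lemma IsCentredOrthogonal.mul_anomaly {B : Matrix (Fin n) (Fin K₁) ℝ}
    {A : Matrix (Fin n) (Fin K₂) ℝ} (h : IsCentredOrthogonal B A) : Bᵀ * anomaly A = 0 := by
  rw [anomaly, ← Matrix.mul_assoc, h.orthogonal, Matrix.zero_mul]

/-- The matrix inner product with a difference of underlying matrices. -/
lemma sum_mul_sub_le {U : Matrix (Fin n) (Fin n) ℝ} {u : ℝ} (hu : 0 ≤ u)
    (hU : ∀ x y : Fin n → ℝ,
      ∑ i, ∑ j, x i * U i j * y j ≤ u * (√(∑ i, x i ^ 2) * √(∑ j, y j ^ 2)))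
    (B B' : Matrix (Fin n) (Fin K₁) ℝ) (A A' : Matrix (Fin n) (Fin K₂) ℝ) :
    ∑ i, ∑ j, U i j * (balance B' + anomaly A' - (balance B + anomaly A)) i j
      ≤ u * √(2 * ((K₁ : ℝ) + K₂ + 2)) *
        ‖balance B' + anomaly A' - (balance B + anomaly A)‖ := by
  -- Concatenating the factors of both matrices writes the difference with inner dimension `2(K +
  -- 2)`.
  have h : balance B' + anomaly A' - (balance B + anomaly A)
      = Matrix.fromCols (leftFactor B' A') (-leftFactor B A) *
        Matrix.fromRows (rightFactor B' A') (rightFactor B A) := by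
    rw [Matrix.fromCols_mul_fromRows, Matrix.neg_mul, leftFactor_mul_rightFactor,
      leftFactor_mul_rightFactor, sub_eq_add_neg]
  rw [h]
  refine (sum_mul_le_of_factor hu hU _ _).trans (le_of_eq ?_)
  have : ((Fintype.card ((Fin 2 ⊕ Fin K₁ ⊕ Fin K₂) ⊕ (Fin 2 ⊕ Fin K₁ ⊕ Fin K₂)) : ℕ) : ℝ)
      = 2 * ((K₁ : ℝ) + K₂ + 2) := by
    simp only [Fintype.card_sum, Fintype.card_fin]; push_cast; ring
  rw [this]

variable {f : ℝ → ℝ} {d₀ d₁ C κ a : ℝ}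

/-- The estimation error of the anomaly matrix, given a bound on the score. -/
theorem norm_anomaly_sub_le (hn : 0 < n) (hf : IsLink f) (hd₀ : 0 ≤ d₀) (hC : 0 < C) (ha : 0 ≤ a)
    (hpos : ∀ t ∈ support, ∀ x : ℝ, |x| ≤ 5 * C ^ 2 + d₀ → 0 < pointProb f d₀ d₁ t x)
    (hH : 0 < curvature f d₀ d₁ (5 * C ^ 2 + d₀)) {y : Matrix (Fin n) (Fin n) ℤ}
    (hy : ∀ i j, y i j ∈ support) {B B' : Matrix (Fin n) (Fin K₁) ℝ}
    {A A' : Matrix (Fin n) (Fin K₂) ℝ} (h : IsFeasible C κ a B A)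
    (h' : IsEstimate f d₀ d₁ C κ a y B' A') {u : ℝ} (hu : 0 ≤ u)
    (hU : ∀ x z : Fin n → ℝ, ∑ i, ∑ j, x i * score f d₀ d₁ y (balance B + anomaly A) i j * z j
      ≤ u * (√(∑ i, x i ^ 2) * √(∑ j, z j ^ 2)))
    {σ d : ℝ} (hσ : 0 < σ) (hB : ∀ v : Fin K₁ → ℝ, σ * ∑ l, v l ^ 2 ≤ ∑ i, (B *ᵥ v) i ^ 2)
    (heσ : 3 * (κ ^ 2 * C ^ 2 * (n * a)) ≤ σ) (hdσ : 3 * d ≤ σ)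
    (hd : 2 * u * √(2 * ((K₁ : ℝ) + K₂ + 2)) ≤ curvature f d₀ d₁ (5 * C ^ 2 + d₀) * d) :
    ‖anomaly A' - anomaly A‖ ≤ 3 * d := by
  set H := curvature f d₀ d₁ (5 * C ^ 2 + d₀) with hHd
  have bound : ∀ {B : Matrix (Fin n) (Fin K₁) ℝ} {A : Matrix (Fin n) (Fin K₂) ℝ},
      IsFeasible C κ a B A → ∀ i j, |(balance B + anomaly A) i j| ≤ 5 * C ^ 2 + d₀ :=
    fun hf i j => (abs_entry_le hC.le hf.bound_left hf.bound_right i j).trans (by linarith)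
  have h1 := sum_sq_le_of_logLik_le hf hpos hH hy (bound h) (bound h'.feasible)
    (neg_le_neg_iff.1 (h'.minimal B A h))
  have h2 := h1.trans (sum_mul_sub_le hu hU B B' A A')
  rw [← frobenius_sq, ← hHd] at h2
  have hΔ : ‖balance B' + anomaly A' - (balance B + anomaly A)‖ ≤ d := by
    set D := ‖balance B' + anomaly A' - (balance B + anomaly A)‖ with hD
    have hD0 : 0 ≤ D := norm_nonneg _
    rcases hD0.eq_or_lt with h0 | h0
    · rw [← h0]
      have : 0 ≤ H * d := le_trans (by positivity) hd
      exact nonneg_of_mul_nonneg_right this hH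
    · have h3 : D * (H * D) ≤ D * (H * d) := by nlinarith
      exact le_of_mul_le_mul_left (le_of_mul_le_mul_left h3 h0) hH
  exact anomaly_perturbation hσ hB (anomaly_transpose A) (anomaly_transpose A')
    h.centred.mul_anomaly h'.feasible.centred.mul_anomaly (h.norm_anomaly_le hC.le ha)
    (h'.feasible.norm_anomaly_le hC.le ha) heσ hdσ
    ((norm_centred_diff_le hn h.centred h'.feasible.centred).trans hΔ)

lemma mul_ncard_le_norm_sq (D : Matrix (Fin n) (Fin n) ℝ) {η : ℝ} (hη : 0 ≤ η)
    {s : Set (Fin n × Fin n)} (hs : ∀ e ∈ s, η ≤ |D e.1 e.2|) : η ^ 2 * s.ncard ≤ ‖D‖ ^ 2 := by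
  classical
  rw [frobenius_sq, Set.ncard_eq_toFinset_card', mul_comm, ← nsmul_eq_mul]
  simp only [← Finset.sum_product', Finset.univ_product_univ]
  calc s.toFinset.card • η ^ 2 = ∑ e ∈ s.toFinset, η ^ 2 := by simp
    _ ≤ ∑ e ∈ s.toFinset, D e.1 e.2 ^ 2 := Finset.sum_le_sum fun e he => by
        rw [← sq_abs (D e.1 e.2)]
        have := hs e (Set.mem_toFinset.1 he)
        gcongr
    _ ≤ ∑ e : Fin n × Fin n, D e.1 e.2 ^ 2 := Finset.sum_le_univ_sum_of_nonneg fun _ => sq_nonneg _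

/-- The false discovery proportion of thresholding an accurate estimate. -/
lemma fdp_le {S S' : Matrix (Fin n) (Fin n) ℝ} {η T N : ℝ} (hη : 0 < η) (hT : ‖S' - S‖ ≤ T)
    (hsig : ∀ i j, S i j ≠ 0 → 2 * η ≤ |S i j|) (hN : N ≤ zeroNorm S) (hN0 : 0 < N)
    (hTN : 2 * T ^ 2 ≤ η ^ 2 * N) : fdp S S' η ≤ 2 * T ^ 2 / (η ^ 2 * N) := by
  have hT2 : ‖S' - S‖ ^ 2 ≤ T ^ 2 := by gcongr
  set disc := {e : Fin n × Fin n | η < |S' e.1 e.2|} with hdisc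
  set miss := {e : Fin n × Fin n | S e.1 e.2 ≠ 0 ∧ |S' e.1 e.2| ≤ η} with hmiss
  set fd := {e : Fin n × Fin n | η < |S' e.1 e.2| ∧ S e.1 e.2 = 0} with hfd
  have h1 : η ^ 2 * fd.ncard ≤ T ^ 2 := by
    refine (mul_ncard_le_norm_sq (S' - S) hη.le fun e he => ?_).trans hT2
    have he' : η < |S' e.1 e.2| ∧ S e.1 e.2 = 0 := he
    rw [Matrix.sub_apply, he'.2, sub_zero]
    exact he'.1.le
  have h2 : η ^ 2 * miss.ncard ≤ T ^ 2 := by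
    refine (mul_ncard_le_norm_sq (S' - S) hη.le fun e he => ?_).trans hT2
    have he' : S e.1 e.2 ≠ 0 ∧ |S' e.1 e.2| ≤ η := he
    have h3 := hsig _ _ he'.1
    have h4 := abs_sub_abs_le_abs_sub (S e.1 e.2) (S' e.1 e.2)
    rw [Matrix.sub_apply, abs_sub_comm]
    linarith [he'.2]
  -- Every nonzero entry is missed or discovered. By `hTN` the misses number at most `N/2`, so at
  -- least `N/2` entries are discovered.
  have h3 : (zeroNorm S : ℝ) ≤ miss.ncard + disc.ncard := by
    have : zeroNorm S ≤ miss.ncard + disc.ncard := by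
      refine (Set.ncard_le_ncard (fun e he => ?_) (Set.toFinite _)).trans
        (Set.ncard_union_le miss disc)
      have he' : S e.1 e.2 ≠ 0 := he
      rcases le_or_gt |S' e.1 e.2| η with h | h
      · exact Or.inl ⟨he', h⟩
      · exact Or.inr h
    exact_mod_cast this
  have hη2 : 0 < η ^ 2 := by positivity
  have h4 : η ^ 2 * N ≤ 2 * (η ^ 2 * disc.ncard) := by
    have := mul_le_mul_of_nonneg_left (hN.trans h3) hη2.le
    nlinarith
  have h5 : (disc.ncard : ℝ) ≤ max (disc.ncard : ℝ) 1 := le_max_left _ _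
  have h6 : η ^ 2 * N ≤ 2 * (η ^ 2 * max (disc.ncard : ℝ) 1) :=
    h4.trans (by gcongr)
  rw [fdp, ← hfd, ← hdisc, div_le_div_iff₀ (by positivity) (by positivity)]
  have h7 : (0 : ℝ) ≤ fd.ncard := by positivity
  calc (fd.ncard : ℝ) * (η ^ 2 * N) ≤ fd.ncard * (2 * (η ^ 2 * max (disc.ncard : ℝ) 1)) := by gcongr
    _ = 2 * (η ^ 2 * fd.ncard) * max (disc.ncard : ℝ) 1 := by ring
    _ ≤ 2 * T ^ 2 * max (disc.ncard : ℝ) 1 := by gcongr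

lemma fdp_le_one (S S' : Matrix (Fin n) (Fin n) ℝ) (η : ℝ) : fdp S S' η ≤ 1 := by
  rw [fdp, div_le_one (by positivity)]
  refine le_trans ?_ (le_max_left _ _)
  exact_mod_cast Set.ncard_le_ncard
    (fun (e : Fin n × Fin n) (he : η < |S' e.1 e.2| ∧ S e.1 e.2 = 0) => he.1) (Set.toFinite _)

lemma minSignal_nonneg (X : Matrix (Fin n) (Fin n) ℝ) : 0 ≤ minSignal X :=
  Real.sInf_nonneg (by rintro r ⟨i, j, -, rfl⟩; exact abs_nonneg _)

lemma minSignal_le (X : Matrix (Fin n) (Fin n) ℝ) {i j : Fin n} (h : X i j ≠ 0) :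
    minSignal X ≤ |X i j| :=
  csInf_le ⟨0, by rintro r ⟨i, j, -, rfl⟩; exact abs_nonneg _⟩ ⟨i, j, h, rfl⟩

end Deterministic

-- Consequences of the convergence of the Gram matrices.

section Gram

variable {k : ℕ}

/-- The minimum over the compact unit sphere works; the sphere is empty when `k = 0`, where any
constant does. -/
lemma exists_quadForm_ge {S : Matrix (Fin k) (Fin k) ℝ} (hS : S.PosDef) :
    ∃ σ : ℝ, 0 < σ ∧ ∀ v : Fin k → ℝ, σ * ∑ l, v l ^ 2 ≤ v ⬝ᵥ S *ᵥ v := by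
  let s : Set (Fin k → ℝ) := {v | ∑ l, v l ^ 2 = 1}
  have hclosed : IsClosed s := isClosed_eq (by fun_prop) continuous_const
  have hcomp : IsCompact s := by
    refine (isCompact_Icc (a := fun _ : Fin k => (-1 : ℝ)) (b := fun _ => 1)).of_isClosed_subset
      hclosed fun v hv => ?_
    have h1 : ∀ l, |v l| ≤ 1 := fun l => by
      rw [← sq_le_one_iff_abs_le_one, ← show ∑ l, v l ^ 2 = 1 from hv]
      exact Finset.single_le_sum (f := fun l => v l ^ 2) (fun l _ => sq_nonneg _)
        (Finset.mem_univ l)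
    exact ⟨fun l => (abs_le.1 (h1 l)).1, fun l => (abs_le.1 (h1 l)).2⟩
  have hcont : Continuous fun v : Fin k → ℝ => v ⬝ᵥ S *ᵥ v := by
    simp only [dotProduct, Matrix.mulVec]
    fun_prop
  have hzero : ∀ v : Fin k → ℝ, ∑ l, v l ^ 2 = 0 → v = 0 := fun v hv => by
    ext l
    have := (Finset.sum_eq_zero_iff_of_nonneg fun l _ => sq_nonneg (v l)).1 hv l
      (Finset.mem_univ l)
    simpa using this
  -- homogeneity
  have hscale : ∀ σ : ℝ, (∀ v ∈ s, σ ≤ v ⬝ᵥ S *ᵥ v) →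
      ∀ v : Fin k → ℝ, σ * ∑ l, v l ^ 2 ≤ v ⬝ᵥ S *ᵥ v := by
    intro σ hσ v
    have h0 : 0 ≤ ∑ l, v l ^ 2 := by positivity
    rcases h0.eq_or_lt with h | h
    · rw [hzero v h.symm]; simp
    · set r := √(∑ l, v l ^ 2) with hr
      have hr0 : 0 < r := Real.sqrt_pos.2 h
      have hr2 : r ^ 2 = ∑ l, v l ^ 2 := Real.sq_sqrt h0
      have hmem : r⁻¹ • v ∈ s := by
        change ∑ l, (r⁻¹ * v l) ^ 2 = 1
        simp only [mul_pow, ← Finset.mul_sum]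
        rw [← hr2]
        field_simp
      have h1 := hσ _ hmem
      rw [Matrix.mulVec_smul, smul_dotProduct, dotProduct_smul, smul_eq_mul, smul_eq_mul,
        ← mul_assoc, ← sq, inv_pow, hr2, inv_mul_eq_div, le_div_iff₀ h] at h1
      exact h1
  rcases s.eq_empty_or_nonempty with hs | hs
  · exact ⟨1, one_pos, hscale 1 (by simp [hs])⟩
  · obtain ⟨w, hw, hmin⟩ := hcomp.exists_isMinOn hs hcont.continuousOn
    refine ⟨w ⬝ᵥ S *ᵥ w, ?_, hscale _ fun v hv => hmin hv⟩
    refine hS.dotProduct_mulVec_pos fun h0 => ?_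
    have : ∑ l, w l ^ 2 = 1 := hw
    simp [h0] at this

lemma tendsto_entry {X : ℕ → Matrix (Fin k) (Fin k) ℝ} {S : Matrix (Fin k) (Fin k) ℝ}
    (h : Tendsto X atTop (𝓝 S)) (i j : Fin k) :
    Tendsto (fun n => X n i j) atTop (𝓝 (S i j)) :=
  ((continuous_id.matrix_elem i j).tendsto S).comp h

lemma gram_quadForm {n : ℕ} (B : Matrix (Fin n) (Fin k) ℝ) (v : Fin k → ℝ) :
    v ⬝ᵥ (Bᵀ * B) *ᵥ v = ∑ i, (B *ᵥ v) i ^ 2 := by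
  rw [sum_sq_eq_dotProduct, ← Matrix.mulVec_mulVec, Matrix.dotProduct_mulVec,
    Matrix.vecMul_transpose]

lemma tendsto_gram_trace {B : ∀ n, Matrix (Fin n) (Fin k) ℝ} {c : ℕ → ℝ}
    {S : Matrix (Fin k) (Fin k) ℝ} (h : Tendsto (fun n => c n • ((B n)ᵀ * B n)) atTop (𝓝 S)) :
    Tendsto (fun n => c n * ∑ i, ∑ l, B n i l ^ 2) atTop (𝓝 S.trace) := by
  have h1 : Tendsto (fun n => ∑ l, (c n • ((B n)ᵀ * B n)) l l) atTop (𝓝 (∑ l, S l l)) :=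
    tendsto_finsetSum _ fun l _ => tendsto_entry h l l
  refine h1.congr fun n => ?_
  rw [Finset.sum_comm, Finset.mul_sum]
  simp [Matrix.mul_apply, sq]

/-- The scaled Gram matrix is eventually within half the lower bound of its limit. -/
lemma eventually_gram_ge {B : ∀ n, Matrix (Fin n) (Fin k) ℝ} {S : Matrix (Fin k) (Fin k) ℝ}
    (hS : S.PosDef) (h : Tendsto (fun n : ℕ => (1 / (n : ℝ)) • ((B n)ᵀ * B n)) atTop (𝓝 S)) :
    ∃ σ : ℝ, 0 < σ ∧ ∀ᶠ n : ℕ in atTop, ∀ v : Fin k → ℝ,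
      σ * n * ∑ l, v l ^ 2 ≤ ∑ i, (B n *ᵥ v) i ^ 2 := by
  obtain ⟨σ, hσ, hq⟩ := exists_quadForm_ge hS
  refine ⟨σ / 2, half_pos hσ, ?_⟩
  have h1 : Tendsto (fun n : ℕ => ∑ i, ∑ j, ((1 / (n : ℝ)) • ((B n)ᵀ * B n) - S) i j ^ 2) atTop
      (𝓝 (∑ i : Fin k, ∑ j : Fin k, (0 : ℝ) ^ 2)) := by
    refine tendsto_finsetSum _ fun i _ => tendsto_finsetSum _ fun j _ => ?_
    have := (tendsto_entry h i j).sub_const (S i j)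
    rw [sub_self] at this
    exact this.pow 2
  simp only [ne_eq, OfNat.ofNat_ne_zero, not_false_eq_true, zero_pow, Finset.sum_const_zero] at h1
  filter_upwards [h1.eventually_le_const (show (0 : ℝ) < (σ / 2) ^ 2 by positivity),
    eventually_gt_atTop 0] with n hn hn0 v
  have hn' : (0 : ℝ) < n := by exact_mod_cast hn0
  rw [← frobenius_sq] at hn
  have h2 := abs_le_of_sq_le_sq' hn (by positivity) |>.2
  have h3 := neg_quadForm_le ((1 / (n : ℝ)) • ((B n)ᵀ * B n) - S) v
  rw [Matrix.sub_mulVec, dotProduct_sub, Matrix.smul_mulVec, dotProduct_smul, gram_quadForm,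
    smul_eq_mul] at h3
  have h4 := hq v
  have h0 : 0 ≤ ∑ l, v l ^ 2 := by positivity
  have h5 : σ / 2 * ∑ l, v l ^ 2 ≤ 1 / (n : ℝ) * ∑ i, (B n *ᵥ v) i ^ 2 := by
    nlinarith [mul_le_mul_of_nonneg_right h2 h0]
  rw [one_div, inv_mul_eq_div, le_div_iff₀ hn'] at h5
  linarith

end Gram

-- Choice of constants for large `n`.

section Asymptotics

variable {f : ℝ → ℝ} {d₀ d₁ C κ : ℝ} {K₁ K₂ : ℕ} {a η : ℕ → ℝ}
  {B : ∀ n, Matrix (Fin n) (Fin K₁) ℝ} {A : ∀ n, Matrix (Fin n) (Fin K₂) ℝ}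

/-- The scale constraint is the one at issue: after division by `n a_n` the two squared norms tend
to `tr Σ₂` and `κ² tr Σ₁`, and the strict inequality of the limits passes to large `n`. -/
lemma eventually_feasible (hκ : 0 < κ) (ha : ∀ n, 0 < a n) (h1 : ConditionA1 f d₀ d₁ C B A)
    (h2 : ConditionA2 B A) (h3 : ConditionA3 κ a B A) :
    ∀ᶠ n in atTop, IsFeasible C κ (a n) (B n) (A n) := by
  obtain ⟨S₁, S₂, -, -, htr, -, -, hB, hA⟩ := h3
  have h4 := (tendsto_gram_trace hB).const_mul (κ ^ 2)
  filter_upwards [(tendsto_gram_trace hA).eventually_lt h4 htr, eventually_gt_atTop 0] with n hn hn0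
  refine ⟨h1.bound_left n, h1.bound_right n, h2 n, ?_⟩
  have hn' : (0 : ℝ) < n := by exact_mod_cast hn0
  have han := ha n
  rw [frobeniusNorm, frobeniusNorm]
  refine Real.sqrt_le_iff.2 ⟨by positivity, ?_⟩
  rw [mul_pow, mul_pow, Real.sq_sqrt han.le, Real.sq_sqrt (by positivity)]
  rw [one_div, one_div, inv_mul_eq_div, div_lt_iff₀ (by positivity)] at hn
  refine hn.le.trans (le_of_eq ?_)
  field_simp

lemma rate_sq (n : ℕ) : rate f d₀ d₁ C K₁ K₂ n ^ 2 = 4.02 ^ 2 * (2 * ((K₁ : ℝ) + K₂ + 2) / n) *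
    steepness f d₀ d₁ (5 * C ^ 2 + d₀) ^ 2 / curvature f d₀ d₁ (5 * C ^ 2 + d₀) ^ 2 := by
  rw [rate, div_pow, mul_pow, mul_pow, Real.sq_sqrt (by positivity)]

lemma tendsto_rate : Tendsto (rate f d₀ d₁ C K₁ K₂) atTop (𝓝 0) := by
  have h1 : Tendsto (fun n : ℕ => √(2 * ((K₁ : ℝ) + K₂ + 2) / n)) atTop (𝓝 0) := by
    rw [← Real.sqrt_zero]
    exact (tendsto_const_div_atTop_nhds_zero_nat _).sqrt
  have h2 := (((h1.const_mul 4.02).mul_const (steepness f d₀ d₁ (5 * C ^ 2 + d₀))).div_const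
    (curvature f d₀ d₁ (5 * C ^ 2 + d₀)))
  simp only [mul_zero, zero_mul, zero_div] at h2
  exact h2

lemma rate_nonneg (hG : 0 < steepness f d₀ d₁ (5 * C ^ 2 + d₀))
    (hH : 0 < curvature f d₀ d₁ (5 * C ^ 2 + d₀)) (n : ℕ) : 0 ≤ rate f d₀ d₁ C K₁ K₂ n := by
  rw [rate]; positivity

lemma fdpRate_eq (n : ℕ) (s η : ℝ) : C ^ 2 * K₂ * rate f d₀ d₁ C K₁ K₂ n ^ 2 / (s ^ 3 * η ^ 2)
    = 2 * 4.02 ^ 2 * fdpRate f d₀ d₁ C K₁ K₂ n s η := by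
  rw [rate_sq, fdpRate]
  rcases eq_or_ne (n : ℝ) 0 with h | h
  · simp [h]
  · field_simp

lemma fdpRate_pos (hC : 0 < C) (hK : 0 < K₂) (hG : 0 < steepness f d₀ d₁ (5 * C ^ 2 + d₀))
    (hH : 0 < curvature f d₀ d₁ (5 * C ^ 2 + d₀)) {n : ℕ} (hn : 0 < n) {s η : ℝ} (hs : 0 < s)
    (hη : 0 < η) : 0 < fdpRate f d₀ d₁ C K₁ K₂ n s η := by
  have : (0 : ℝ) < K₂ := by exact_mod_cast hK
  rw [fdpRate]; positivity

/-- On the event that the score is small, all estimates have a small false discovery proportion. -/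
theorem eventually_fdp_le (hf : IsLink f) (hd₀ : 0 ≤ d₀) (hC : 0 < C) (hκ : 0 < κ)
    (ha : ∀ n, 0 < a n) (ha0 : Tendsto a atTop (𝓝 0)) (hη : ∀ n, 0 < η n)
    (hG : 0 < steepness f d₀ d₁ (5 * C ^ 2 + d₀)) (hK : 0 < K₂)
    (h1 : ConditionA1 f d₀ d₁ C B A) (h2 : ConditionA2 B A) (h3 : ConditionA3 κ a B A)
    (h5 : ConditionA5 (K₁ := K₁) f d₀ d₁ C a A)
    (hηs : η =o[atTop] fun n => minSignal (anomaly (A n)))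
    (hηr : (fun n : ℕ => C * √(K₂ : ℝ) * rate f d₀ d₁ C K₁ K₂ n * a n ^ (-(3 / 2) : ℝ))
      =o[atTop] η) :
    ∀ᶠ n : ℕ in atTop, ∀ y : Matrix (Fin n) (Fin n) ℤ, (∀ i j, y i j ∈ support) →
      (∀ x z : Fin n → ℝ,
        ∑ i, ∑ j, x i * score f d₀ d₁ y (balance (B n) + anomaly (A n)) i j * z j ≤
          60 * steepness f d₀ d₁ (5 * C ^ 2 + d₀) * √n *
            (√(∑ i, x i ^ 2) * √(∑ j, z j ^ 2))) →
      ∀ (Bh : Matrix (Fin n) (Fin K₁) ℝ) (Ah : Matrix (Fin n) (Fin K₂) ℝ),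
        IsEstimate f d₀ d₁ C κ (a n) y Bh Ah →
          fdp (anomaly (A n)) (anomaly Ah) (η n) ≤ 33 * fdpRate f d₀ d₁ C K₁ K₂ n (a n) (η n) := by
  have hH := h1.curvature_pos
  have hK' : (0 : ℝ) < K₂ := by exact_mod_cast hK
  obtain ⟨σ, hσ, hgram⟩ : ∃ σ : ℝ, 0 < σ ∧ ∀ᶠ n : ℕ in atTop, ∀ v : Fin K₁ → ℝ,
      σ * n * ∑ l, v l ^ 2 ≤ ∑ i, (B n *ᵥ v) i ^ 2 := by
    obtain ⟨S₁, S₂, hS₁, -, -, -, -, hB, -⟩ := h3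
    exact eventually_gram_ge hS₁ hB
  obtain ⟨c₀, hc₀, hsp⟩ := h5.sparsity
  have hsmall1 : ∀ᶠ n in atTop, 3 * (κ ^ 2 * C ^ 2 * a n) ≤ σ := by
    have := (ha0.const_mul (κ ^ 2 * C ^ 2)).const_mul 3
    simp only [mul_zero] at this
    exact this.eventually_le_const hσ
  have hsmall2 : ∀ᶠ n in atTop, 90 * rate f d₀ d₁ C K₁ K₂ n ≤ σ := by
    have := (tendsto_rate (f := f) (d₀ := d₀) (d₁ := d₁) (C := C) (K₁ := K₁) (K₂ := K₂)).const_mul 90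
    simp only [mul_zero] at this
    exact this.eventually_le_const hσ
  -- `16200 = 2 · 90²` comes from `2T²` with `T = 90 n r`. Here `a_n → 0` removes `c₀` from the
  -- final constant.
  have hsmall3 : ∀ᶠ n in atTop, 16200 * c₀ * a n ≤ C ^ 2 * K₂ := by
    have := ha0.const_mul (16200 * c₀)
    rw [mul_zero] at this
    exact this.eventually_le_const (by positivity)
  filter_upwards [hgram, hsp, hsmall1, hsmall2, hsmall3, eventually_feasible hκ ha h1 h2 h3,
    hηs.bound (show (0 : ℝ) < 1 / 2 by norm_num), hηr.bound one_pos, eventually_gt_atTop 0]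
    with n hgram hsp hs1 hs2 hs3 hfeas hsig hηr hn0 y hy hU Bh Ah hest
  have hn : (0 : ℝ) < n := by exact_mod_cast hn0
  have han := ha n
  have hηn := hη n
  set G := steepness f d₀ d₁ (5 * C ^ 2 + d₀) with hGd
  set H := curvature f d₀ d₁ (5 * C ^ 2 + d₀) with hHd
  set r := rate f d₀ d₁ C K₁ K₂ n with hrd
  have hr0 : 0 ≤ r := rate_nonneg hG hH n
  -- The choice `d = 30 n r` works because `30 · 4.02 = 120.6` exceeds the required `2 · 60`.
  have herr := norm_anomaly_sub_le hn0 hf hd₀ hC han.le h1.pos hH hy hfeas hest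
    (u := 60 * G * √n) (by positivity) hU (σ := σ * n) (d := 30 * n * r) (by positivity) hgram
    (by nlinarith) (by nlinarith) (by
      have h6 : √(2 * ((K₁ : ℝ) + K₂ + 2) / n) * n = √(2 * ((K₁ : ℝ) + K₂ + 2)) * √n := by
        rw [Real.sqrt_div (by positivity), div_mul_eq_mul_div, div_eq_iff (by positivity), mul_assoc,
          Real.mul_self_sqrt hn.le]
      have h7 : H * (30 * n * r) = 120.6 * G * (√(2 * ((K₁ : ℝ) + K₂ + 2)) * √n) := by
        rw [← h6, hrd, rate, ← hGd, ← hHd]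
        field_simp
        norm_num
      rw [h7]
      have : 0 ≤ G * (√(2 * ((K₁ : ℝ) + K₂ + 2)) * √n) := by positivity
      linarith)
  -- `C² K₂ r² ≤ a³ η²`
  have hkey : C ^ 2 * K₂ * r ^ 2 ≤ a n ^ 3 * η n ^ 2 := by
    rw [one_mul, Real.norm_of_nonneg (by positivity), Real.norm_of_nonneg hηn.le] at hηr
    have h6 : (C * √(K₂ : ℝ) * r * a n ^ (-(3 / 2) : ℝ)) ^ 2 ≤ η n ^ 2 := by gcongr
    have h7 : (a n ^ (-(3 / 2) : ℝ)) ^ 2 = (a n ^ 3)⁻¹ := by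
      rw [← Real.rpow_natCast, ← Real.rpow_mul han.le, ← Real.rpow_natCast, ← Real.rpow_neg han.le]
      norm_num
    rw [mul_pow, mul_pow, mul_pow, Real.sq_sqrt hK'.le, h7, ← div_eq_mul_inv,
      div_le_iff₀ (by positivity)] at h6
    linarith
  have hc₀r : 16200 * c₀ * r ^ 2 * a n ≤ C ^ 2 * K₂ * r ^ 2 := by
    nlinarith [mul_le_mul_of_nonneg_right hs3 (sq_nonneg r)]
  have hN0 : 0 < c₀⁻¹ * (n : ℝ) ^ 2 * a n ^ 2 := by positivity
  -- This is the condition `2T² ≤ η²N` of `fdp_le` with `N = c₀⁻¹ n² a²`: misses are at most `N/2`.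
  have h8 : 16200 * c₀ * r ^ 2 ≤ a n ^ 2 * η n ^ 2 := by
    refine le_of_mul_le_mul_right (a := a n) ?_ han
    calc 16200 * c₀ * r ^ 2 * a n ≤ a n ^ 3 * η n ^ 2 := hc₀r.trans hkey
      _ = a n ^ 2 * η n ^ 2 * a n := by ring
  have hfdp := fdp_le (T := 3 * (30 * n * r)) hηn herr (fun i j hij => by
      have := minSignal_le (anomaly (A n)) hij
      rw [Real.norm_of_nonneg hηn.le, Real.norm_of_nonneg (minSignal_nonneg _)] at hsig
      linarith) hsp.1 hN0 (by
      calc 2 * (3 * (30 * n * r)) ^ 2 = c₀⁻¹ * n ^ 2 * (16200 * c₀ * r ^ 2) := by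
            field_simp; ring
        _ ≤ c₀⁻¹ * n ^ 2 * (a n ^ 2 * η n ^ 2) := by gcongr
        _ = _ := by ring)
  refine hfdp.trans ?_
  have h9 : 2 * (3 * (30 * n * r)) ^ 2 / (η n ^ 2 * (c₀⁻¹ * n ^ 2 * a n ^ 2))
      = 16200 * c₀ * r ^ 2 * a n / (a n ^ 3 * η n ^ 2) := by
    field_simp; ring
  rw [h9]
  calc 16200 * c₀ * r ^ 2 * a n / (a n ^ 3 * η n ^ 2)
      ≤ C ^ 2 * K₂ * r ^ 2 / (a n ^ 3 * η n ^ 2) := by gcongr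
    _ = 2 * 4.02 ^ 2 * fdpRate f d₀ d₁ C K₁ K₂ n (a n) (η n) := fdpRate_eq _ _ _
    _ ≤ _ := by
      have := fdpRate_pos (K₁ := K₁) hC hK hG hH hn0 han hηn
      nlinarith

end Asymptotics

end SignedNetwork

-- The theorem.

open SignedNetwork in
theorem mainTheorem4 :
    ∃ C₁ C₂ c : ℝ, 0 < C₁ ∧ 0 < C₂ ∧ 0 < c ∧
      ∀ (f : ℝ → ℝ) (d₀ d₁ C κ : ℝ) (K₁ K₂ : ℕ) (a η : ℕ → ℝ)
        (B : ∀ n, Matrix (Fin n) (Fin K₁) ℝ) (A : ∀ n, Matrix (Fin n) (Fin K₂) ℝ)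
        (Ω : ℕ → Type*) (mΩ : ∀ n, MeasurableSpace (Ω n)) (P : ∀ n, Measure (Ω n))
        (Y : ∀ n, Ω n → Matrix (Fin n) (Fin n) ℤ),
        IsLink f → 0 ≤ d₀ → 0 < C → 0 < κ →
        (∀ n, 0 < a n) → Tendsto a atTop (𝓝 0) → (∀ n, 0 < η n) →
        (∀ n, IsProbabilityMeasure (P n)) →
        (∀ n, IsSignedNetwork f d₀ d₁ (balance (B n) + anomaly (A n)) (P n) (Y n)) →
        ConditionA1 f d₀ d₁ C B A →
        ConditionA2 B A →
        ConditionA3 κ a B A →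
        ConditionA5 (K₁ := K₁) f d₀ d₁ C a A →
        (η =o[atTop] fun n => minSignal (anomaly (A n))) →
        ((fun n : ℕ => C * √(K₂ : ℝ) * rate f d₀ d₁ C K₁ K₂ n * a n ^ (-(3 / 2) : ℝ))
          =o[atTop] η) →
        (∀ᶠ n : ℕ in atTop,
          1 - C₁ * Real.exp (-C₂ * n) ≤
            (P n).real {ω | ∀ (Bh : Matrix (Fin n) (Fin K₁) ℝ) (Ah : Matrix (Fin n) (Fin K₂) ℝ),
              IsEstimate f d₀ d₁ C κ (a n) (Y n ω) Bh Ah →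
                fdp (anomaly (A n)) (anomaly Ah) (η n) ≤
                  c * fdpRate f d₀ d₁ C K₁ K₂ n (a n) (η n)}) ∧
        ∃ c' : ℝ, 0 < c' ∧ ∀ n : ℕ, 1 ≤ n →
          1 - C₁ * Real.exp (-C₂ * n) ≤
            (P n).real {ω | ∀ (Bh : Matrix (Fin n) (Fin K₁) ℝ) (Ah : Matrix (Fin n) (Fin K₂) ℝ),
              IsEstimate f d₀ d₁ C κ (a n) (Y n ω) Bh Ah →
                fdp (anomaly (A n)) (anomaly Ah) (η n) ≤
                  c' * fdpRate f d₀ d₁ C K₁ K₂ n (a n) (η n)} := by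

  refine ⟨1, 1, 33, one_pos, one_pos, by norm_num, ?_⟩
  intro f d₀ d₁ C κ K₁ K₂ a η B A Ω mΩ P Y hf hd₀ hC hκ ha ha0 hη hP hY h1 h2 h3 h5 hηs hηr
  have hα : 0 < 5 * C ^ 2 + d₀ := by positivity
  have hG := steepness_pos hα h1.pos h1.steepness_finite h1.curvature_pos
  -- If `K₂ = 0` then the anomaly matrix vanishes and its minimal signal is the infimum of the empty
  -- set, `0`, so `η = o(0)` contradicts `η > 0`. Positivity of `K₂` makes the rate positive.
  have hK : 0 < K₂ := by
    rcases Nat.eq_zero_or_pos K₂ with rfl | h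
    · exfalso
      have hz : ∀ n, minSignal (anomaly (A n)) = 0 := fun n => by
        have : {r : ℝ | ∃ i j, anomaly (A n) i j ≠ 0 ∧ r = |anomaly (A n) i j|} = ∅ := by
          ext r; simp [anomaly, Matrix.mul_apply]
        rw [minSignal, this, Real.sInf_empty]
      obtain ⟨n, hn⟩ := (hηs.bound one_pos).exists
      rw [hz, norm_zero, mul_zero] at hn
      exact (hη n).ne' (norm_le_zero_iff.1 hn)
    · exact h
  have hscore : ∀ n : ℕ, 1 - 1 * Real.exp (-1 * n) ≤ (P n).real {ω | ∀ x y : Fin n → ℝ,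
      ∑ i, ∑ j, x i * score f d₀ d₁ (Y n ω) (balance (B n) + anomaly (A n)) i j * y j ≤
        60 * steepness f d₀ d₁ (5 * C ^ 2 + d₀) * √n *
          (√(∑ i, x i ^ 2) * √(∑ j, y j ^ 2))} := fun n => by
    have := hP n
    rw [one_mul, neg_one_mul]
    exact measure_score_ge hf (hY n) (entry_symm _ _) h1.pos h1.steepness_finite hG fun i j =>
      (abs_entry_le hC.le (h1.bound_left n) (h1.bound_right n) i j).trans (by linarith)
  have hev := eventually_fdp_le hf hd₀ hC hκ ha ha0 hη hG hK h1 h2 h3 h5 hηs hηr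
  obtain ⟨N, hN⟩ := eventually_atTop.1 hev
  have hlarge : ∀ n, N ≤ n → ∀ c : ℝ, 33 ≤ c → 1 - 1 * Real.exp (-1 * n) ≤
      (P n).real {ω | ∀ (Bh : Matrix (Fin n) (Fin K₁) ℝ) (Ah : Matrix (Fin n) (Fin K₂) ℝ),
        IsEstimate f d₀ d₁ C κ (a n) (Y n ω) Bh Ah → fdp (anomaly (A n)) (anomaly Ah) (η n) ≤
          c * fdpRate f d₀ d₁ C K₁ K₂ n (a n) (η n)} := by
    intro n hn c hc
    have := hP n
    refine (hscore n).trans (measureReal_mono fun ω hω Bh Ah hest => ?_)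
    refine (hN n hn _ ((hY n).mem_support ω) hω Bh Ah hest).trans ?_
    have h0 : 0 ≤ fdpRate f d₀ d₁ C K₁ K₂ n (a n) (η n) := by
      have := ha n
      rw [fdpRate]; positivity
    gcongr
  refine ⟨eventually_atTop.2 ⟨N, fun n hn => hlarge n hn 33 le_rfl⟩, ?_⟩
  have hpos : ∀ n, 1 ≤ n → 0 < fdpRate f d₀ d₁ C K₁ K₂ n (a n) (η n) := fun n hn =>
    fdpRate_pos hC hK hG h1.curvature_pos hn (ha n) (hη n)
  -- For the finitely many `n < N` the bound is made at least `1`, which every false discovery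
  -- proportion satisfies.
  refine ⟨33 + ∑ n ∈ Finset.Ico 1 N, (fdpRate f d₀ d₁ C K₁ K₂ n (a n) (η n))⁻¹, ?_, ?_⟩
  · have : 0 ≤ ∑ n ∈ Finset.Ico 1 N, (fdpRate f d₀ d₁ C K₁ K₂ n (a n) (η n))⁻¹ :=
      Finset.sum_nonneg fun n hn => (inv_pos.2 (hpos n (Finset.mem_Ico.1 hn).1)).le
    linarith
  · intro n hn
    rcases le_or_gt N n with h | h
    · refine hlarge n h _ ?_
      have : 0 ≤ ∑ n ∈ Finset.Ico 1 N, (fdpRate f d₀ d₁ C K₁ K₂ n (a n) (η n))⁻¹ :=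
        Finset.sum_nonneg fun n hn => (inv_pos.2 (hpos n (Finset.mem_Ico.1 hn).1)).le
      linarith
    · have := hP n
      have huniv : {ω | ∀ (Bh : Matrix (Fin n) (Fin K₁) ℝ) (Ah : Matrix (Fin n) (Fin K₂) ℝ),
          IsEstimate f d₀ d₁ C κ (a n) (Y n ω) Bh Ah → fdp (anomaly (A n)) (anomaly Ah) (η n) ≤
            (33 + ∑ n ∈ Finset.Ico 1 N, (fdpRate f d₀ d₁ C K₁ K₂ n (a n) (η n))⁻¹) *
              fdpRate f d₀ d₁ C K₁ K₂ n (a n) (η n)} = Set.univ := by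
        refine Set.eq_univ_of_forall fun ω Bh Ah _ => (fdp_le_one _ _ _).trans ?_
        have hp := hpos n hn
        have hle : (fdpRate f d₀ d₁ C K₁ K₂ n (a n) (η n))⁻¹
            ≤ ∑ n ∈ Finset.Ico 1 N, (fdpRate f d₀ d₁ C K₁ K₂ n (a n) (η n))⁻¹ :=
          Finset.single_le_sum (f := fun n => (fdpRate f d₀ d₁ C K₁ K₂ n (a n) (η n))⁻¹)
            (fun m hm => (inv_pos.2 (hpos m (Finset.mem_Ico.1 hm).1)).le)
            (Finset.mem_Ico.2 ⟨hn, h⟩)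
        rw [← inv_mul_cancel₀ hp.ne']
        gcongr
        linarith
      rw [huniv, probReal_univ]
      have := Real.exp_pos (-1 * (n : ℝ))
      linarith
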